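/- \textbf{Conventions.} For coprime positive integers $s,r$, or $(s,r)=(1,0)$, the continued fraction of the pair $(s:r)$ is the empty sequence if $(s:r)=(1:0)$, and otherwise $(c_1,c_2,\ldots)$, where $c_1=\lfloor s/r\rfloor$ and $(c_2,\ldots)$ is the continued fraction of $(r:s-c_1r)$; moreover, sequences $(c_1,\ldots,c_{l-1},1)$ and $(c_1,\ldots,c_{l-1}+1)$ with $l\ge 2$ are identified. For $n\ge 0$ let $(q)_n=\prod_{i=1}^n(1-q^i)$, and let $\left[{P\atop N}\right]=\frac{(q)_P}{(q)_N(q)_{P-N}}$ if $P\ge N\ge 0$ and $\left[{P\atop N}\right]=0$ otherwise, where $q$ is an indeterminate. \textbf{Statement.} Let $p$ and $p'$ be positive coprime integers such that $(p':p)$ has continued fraction $(c_1,\ldots,c_{t-1},c_t+2)$ with $t\ge 1$ and all $c_k\ge 0$. Let $1\le u\le t$ and $1\le d\le c_u$, let $r,s$ be such that $(s:r)$ has continued fraction $(c_1,\ldots,c_{u-1},d)$, and let $N\ge 0$ be an integer. Put $$(f_1,\ldots,f_{t+1})=(c_1,\ldots,c_{u-1},d,c_u-d,c_{u+1},\ldots,c_t).$$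 Consider all sequences $n^{(1)},\ldots,n^{(x)}$ with $u\le x\le t+1$, where $n^{(k)}=(n_{k,1},\ldots,n_{k,f_k})$ consists of integers with $n_{k,0}\ge n_{k,1}\ge\cdots\ge n_{k,f_k}\ge 0$ and has weight $\mathrm{wt}(n^{(k)})=\sum_{i=1}^{f_k} n_{k,i}$, such that (i) $\mathrm{wt}(n^{(k)})\le w_k$ for $1\le k\le x$, and $\mathrm{wt}(n^{(x)})=w_x$; (ii) $\mathrm{wt}(n^{(u)})<w_u$ if $u<x$; (iii) $n_{k,f_k}>0$ if $u<k<x$; (iv) $n_{x,f_x}=0$ if $x<t+1$. Here $w_1=\infty$ and $n_{1,0}=N$; for $2\le k\le u$, $w_k=n_{k-1,f_{k-1}}$ and $n_{k,0}=w_{k-1}-\mathrm{wt}(n^{(k-1)})$; $w_{u+1}=w_u-1-\mathrm{wt}(n^{(u)})$ and $n_{u+1,0}=n_{u,f_u}+1$; and for $u+2\le k\le x$, $w_k=n_{k-1,f_{k-1}}-1$ and $n_{k,0}=w_{k-1}+1-\mathrm{wt}(n^{(k-1)})$; with $\infty\pm a=\infty$ for integers $a$. There are finitely many such sequences. Let $$B=\sum_{k=-\infty}^{\infty}\left(q^{k^2pp'+k(p'r-ps)}\left[{2N\atop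 N+pk}\right]-q^{(kp+r)(kp'+s)}\left[{2N\atop N+pk+r}\right]\right),$$ a sum with finitely many non-zero terms, and let $$E=n_{u,d}+\sum_{k=1}^{u}\sum_{i=1}^{f_k}n_{k,i}^2+\sum_{k=u+1}^{x}\sum_{i=1}^{f_k}n_{k,i}(n_{k,i}-1),\qquad G_{k,i}=\left[{2\left(w_k-\sum_{j=1}^{i}n_{k,j}\right)+n_{k,i-1}+n_{k,i}\atop n_{k,i-1}-n_{k,i}}\right].$$ Then $B$ is a polynomial in $q$ with integer coefficients, and the following identities hold, where the sums are over all sequences described above and $\delta$ is the Kronecker delta. If $u>1$, then $$B=(q)_{2N}\sum q^{E}\,\frac{1}{(q)_{2n_{1,f_1}}}\prod_{i=1}^{f_1}\frac{1}{(q)_{n_{1,i-1}-n_{1,i}}}\prod_{k=2}^{x}\;\prod_{i=1+\delta_{2,k}}^{f_k}G_{k,i}.$$ If $u=1$, then $$B=(q)_{2N}\sum q^{E}\,\frac{1}{(q)_{2(n_{2,f_2}-1)}}\prod_{i=1}^{f_1}\frac{1}{(q)_{n_{1,i-1}-n_{1,i}}}\prod_{i=1}^{f_2}\frac{1}{(q)_{n_{2,i-1}-n_{2,i}}}\prod_{k=3}^{x}\;\prod_{i=1+\delta_{3,k}}^{f_k}G_{k,i}.$$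 (If $u=1$, every sequence in the sum has $x\ge 3$ and $n_{2,f_2}\ge 1$.) -/

import Mathlib

namespace BurgeTree

/-! ### Continued fractions of pairs `(s : r)` -/

/-- The canonical continued fraction of the pair `(s : r)`: the empty sequence when `r = 0`, and
otherwise `c₁ = ⌊s / r⌋` followed by the continued fraction of `(r : s - c₁ r)`. -/
def contFrac (s r : ℕ) : List ℕ :=
  if _h : r = 0 then [] else s / r :: contFrac r (s % r)
termination_by r
decreasing_by exact Nat.mod_lt _ (Nat.pos_of_ne_zero _h)

/-- `l` is a continued fraction for `(s : r)`, where `s` and `r` are positive and coprime, or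
`(s : r) = (1 : 0)`. Either `l` is the canonical one, or it is obtained from the canonical one
by replacing its last entry `a + 1` by the two entries `a, 1`. -/
def IsContFrac (l : List ℕ) (s r : ℕ) : Prop :=
  0 < s ∧ Nat.Coprime s r ∧
    (l = contFrac s r ∨
      ∃ (l' : List ℕ) (a : ℕ), contFrac s r = l' ++ [a + 1] ∧ l = l' ++ [a, 1])

/-! ### Gaussian polynomials, as elements of `ℚ(q)` -/

/-- The formal variable `q`. -/
noncomputable def q : RatFunc ℚ := RatFunc.X

/-- `(q)_n = (1 - q)(1 - q²) ⋯ (1 - qⁿ)`. -/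
noncomputable def qPoch (n : ℕ) : RatFunc ℚ := ∏ i ∈ Finset.Icc 1 n, (1 - q ^ i)

/-- The Gaussian `[P; N]`, equal to `(q)_P / ((q)_N (q)_{P-N})` if `P ≥ N ≥ 0` and to `0`
otherwise. -/
noncomputable def gauss (P N : ℤ) : RatFunc ℚ :=
  if 0 ≤ N ∧ N ≤ P then qPoch P.toNat / (qPoch N.toNat * qPoch (P - N).toNat) else 0

/-! ### The bosonic side -/

/-- The `k`-th summand of the bosonic side. -/
noncomputable def bosonicTerm (p p' r s N : ℕ) (k : ℤ) : RatFunc ℚ :=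
  q ^ (k ^ 2 * p * p' + k * (p' * r - p * s)) * gauss (2 * N) (N + p * k)
    - q ^ ((k * p + r) * (k * p' + s)) * gauss (2 * N) (N + p * k + r)

/-! ### Sequences of partitions

A sequence `n⁽¹⁾, …, n⁽ˣ⁾` of partitions is a list of `x` lists of parts. All indices `k` and `i`
below are 1-based, except that `i = 0` refers to the bound `n_{k,0}`. -/

/-- `(f₁, …, f_{t+1}) = (c₁, …, c_{u-1}, d, c_u - d, c_{u+1}, …, c_t)`. -/
def fSeq (c : ℕ → ℕ) (u d k : ℕ) : ℕ :=
  if k < u then c k else if k = u then d else if k = u + 1 then c u - d else c (k - 1)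

/-- The partition `n⁽ᵏ⁾`. -/
def part (n : List (List ℕ)) (k : ℕ) : List ℕ := n.getD (k - 1) []

/-- The weight of `n⁽ᵏ⁾`. -/
def wt (n : List (List ℕ)) (k : ℕ) : ℕ := (part n k).sum

/-- The pair `(w_k, n_{k,0})` of bounds, with `w₁ = ∞` and `n_{1,0} = N`. The value at the
unused index `k = 0` is a dummy. -/
def bounds (f : ℕ → ℕ) (u N : ℕ) (n : List (List ℕ)) : ℕ → ℕ∞ × ℕ∞
  | 0 => (⊤, N)
  | 1 => (⊤, N)
  | k + 2 =>
    let w := (bounds f u N n (k + 1)).1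
    let top := (bounds f u N n (k + 1)).2
    let last : ℕ∞ :=
      if f (k + 1) = 0 then top else ((part n (k + 1)).getD (f (k + 1) - 1) 0 : ℕ)
    if k + 2 ≤ u then (last, w - (wt n (k + 1) : ℕ))
    else if k + 2 = u + 1 then (w - 1 - (wt n (k + 1) : ℕ), last + 1)
    else (last - 1, w + 1 - (wt n (k + 1) : ℕ))

/-- `w_k`. -/
def wBound (f : ℕ → ℕ) (u N : ℕ) (n : List (List ℕ)) (k : ℕ) : ℕ∞ := (bounds f u N n k).1

/-- `n_{k,i}`: the `i`-th part of `n⁽ᵏ⁾` for `i ≥ 1`, and the bound `n_{k,0}` for `i = 0`. -/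
def entry (f : ℕ → ℕ) (u N : ℕ) (n : List (List ℕ)) (k i : ℕ) : ℕ∞ :=
  if i = 0 then (bounds f u N n k).2 else ((part n k).getD (i - 1) 0 : ℕ)

/-- The sequences of partitions over which the fermionic sum is taken; here `x = n.length`. -/
structure Admissible (c : ℕ → ℕ) (t u d N : ℕ) (n : List (List ℕ)) : Prop where
  le_length : u ≤ n.length
  length_le : n.length ≤ t + 1
  length_part : ∀ k, 1 ≤ k → k ≤ n.length → (part n k).length = fSeq c u d k
  antitone : ∀ k, 1 ≤ k → k ≤ n.length → ∀ i, 1 ≤ i → i ≤ fSeq c u d k →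
    entry (fSeq c u d) u N n k i ≤ entry (fSeq c u d) u N n k (i - 1)
  wt_le : ∀ k, 1 ≤ k → k ≤ n.length → (wt n k : ℕ∞) ≤ wBound (fSeq c u d) u N n k
  wt_length : (wt n n.length : ℕ∞) = wBound (fSeq c u d) u N n n.length
  wt_lt : u < n.length → (wt n u : ℕ∞) < wBound (fSeq c u d) u N n u
  last_pos : ∀ k, u < k → k < n.length →
    0 < entry (fSeq c u d) u N n k (fSeq c u d k)
  last_eq_zero : n.length < t + 1 →
    entry (fSeq c u d) u N n n.length (fSeq c u d n.length) = 0

/-! ### The fermionic side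

In an admissible sequence every `w_k` and every `n_{k,i}` that is used below is finite. -/

/-- `n_{k,i}` as a natural number. -/
def entryNat (f : ℕ → ℕ) (u N : ℕ) (n : List (List ℕ)) (k i : ℕ) : ℕ :=
  (entry f u N n k i).toNat

/-- The exponent
`n_{u,d} + ∑_{k=1}^{u} ∑_{i=1}^{f_k} n_{k,i}² + ∑_{k=u+1}^{x} ∑_{i=1}^{f_k} n_{k,i} (n_{k,i} - 1)`. -/
def fermExponent (f : ℕ → ℕ) (u d N : ℕ) (n : List (List ℕ)) : ℕ :=
  entryNat f u N n u d
    + ∑ k ∈ Finset.Icc 1 u, ∑ i ∈ Finset.Icc 1 (f k), entryNat f u N n k i ^ 2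
    + ∑ k ∈ Finset.Icc (u + 1) n.length, ∑ i ∈ Finset.Icc 1 (f k),
        entryNat f u N n k i * (entryNat f u N n k i - 1)

/-- `∏_{i=1}^{f_k} 1 / (q)_{n_{k,i-1} - n_{k,i}}`. -/
noncomputable def invFactor (f : ℕ → ℕ) (u N : ℕ) (n : List (List ℕ)) (k : ℕ) : RatFunc ℚ :=
  ∏ i ∈ Finset.Icc 1 (f k), 1 / qPoch (entryNat f u N n k (i - 1) - entryNat f u N n k i)

/-- The product over `m ≤ k ≤ x` and `1 + δ_{m,k} ≤ i ≤ f_k` of the Gaussians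
`[2 (w_k - ∑_{j=1}^{i} n_{k,j}) + n_{k,i-1} + n_{k,i}; n_{k,i-1} - n_{k,i}]`. -/
noncomputable def gaussFactor (f : ℕ → ℕ) (u N : ℕ) (n : List (List ℕ)) (m : ℕ) : RatFunc ℚ :=
  ∏ k ∈ Finset.Icc m n.length, ∏ i ∈ Finset.Icc (1 + if k = m then 1 else 0) (f k),
    gauss
      (2 * (((wBound f u N n k).toNat : ℤ) - ∑ j ∈ Finset.Icc 1 i, (entryNat f u N n k j : ℤ))
        + entryNat f u N n k (i - 1) + entryNat f u N n k i)
      ((entryNat f u N n k (i - 1) : ℤ) - entryNat f u N n k i)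

/-- The summand of the fermionic sum for `u > 1`. -/
noncomputable def fermTerm (f : ℕ → ℕ) (u d N : ℕ) (n : List (List ℕ)) : RatFunc ℚ :=
  q ^ fermExponent f u d N n
    * (1 / qPoch (2 * entryNat f u N n 1 (f 1)))
    * invFactor f u N n 1
    * gaussFactor f u N n 2

/-- The summand of the fermionic sum for `u = 1`. -/
noncomputable def fermTermOne (f : ℕ → ℕ) (d N : ℕ) (n : List (List ℕ)) : RatFunc ℚ :=
  q ^ fermExponent f 1 d N n
    * (1 / qPoch (2 * (entryNat f 1 N n 2 (f 2) - 1)))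
    * invFactor f 1 N n 1 * invFactor f 1 N n 2
    * gaussFactor f 1 N n 3

end BurgeTree

namespace BurgeTree

/-! ### Gaussian polynomials -/

/-! After division by `(q)_{2N}` the bosonic side is `bosSum p' p s r ⊤ N`, an alternating sum of
products `gaussPair L M a b` at `L = ∞`, `M = N`. The Burge transform (`sum_burgeCoeff_mul_bosSum`,
an instance of the q-Saalschütz summation) writes the sum for `(P'+P, P, S+R, R)` with bounds `(L,
M)` as a sum over `i` of sums for `(P', P, S, R)` with bounds `(L-i, i)`. Iterating it `f_k` times
produces the parts of `n⁽ᵏ⁾`: `L` becomes `w_k` minus the weight and `M` becomes the last part.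
Exchanging `L` and `M` exchanges `P'` with `P` and `S` with `R` (`bosSum_swap`). Together these run
the Euclidean algorithm on `(p' : p)` and `(s : r)` at the same time.

At level `u`, after `d` steps, the second pair has come down to `(0 : 1)`. If `L = 0` the sum is
`δ_{M,0}` (`bosSum_zero_one_zero`): the sequences with `x = u`. Otherwise `bosSum_zero_one` replaces
`(0, 1)` by `(1, 1)` at the cost of `q^M` and of lowering `L` by one: the sequences with `x > u`,
with their factor `q^{n_{u,d}}`.

Beyond level `u`, the Burge transform followed by this same replacement closes up on the shifted sum
`tailSum` and turns the exponent `i²` into `i(i-1)` (`sum_burgeCoeff_mul_tailSum`). It stops at `(2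
: 1)`, where `tailSum` is `δ_{L,0}` (`tailSum_two_one`) because the sum for `(1, 1, 1, 1)` vanishes.

`sum_seqTerm_head` evaluates the sum over all sequences in this way. What remains is to identify
these sequences with the admissible ones, their summands with the stated products, and the resulting
continuants with `p', p, s, r`. -/

theorem q_ne_zero : q ≠ 0 := RatFunc.X_ne_zero

theorem one_sub_q_pow_ne_zero {n : ℕ} (hn : 0 < n) : 1 - q ^ n ≠ 0 := by
  intro h
  have h1 : (algebraMap (Polynomial ℚ) (RatFunc ℚ)) (1 - Polynomial.X ^ n) = 0 := by
    simpa [q] using h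
  rw [map_eq_zero_iff _ (RatFunc.algebraMap_injective ℚ)] at h1
  have h2 := congrArg (Polynomial.eval 0) h1
  simp [hn.ne'] at h2

theorem qPoch_ne_zero (n : ℕ) : qPoch n ≠ 0 :=
  Finset.prod_ne_zero_iff.2 fun _ hi => one_sub_q_pow_ne_zero (Finset.mem_Icc.1 hi).1

@[simp] theorem qPoch_zero : qPoch 0 = 1 := by simp [qPoch]

theorem qPoch_succ (n : ℕ) : qPoch (n + 1) = qPoch n * (1 - q ^ (n + 1)) := by
  rw [qPoch, Finset.prod_Icc_succ_top (by omega), ← qPoch]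

/-- `1 / (q)_z`, understood to be `0` for negative `z`. -/
noncomputable def invPoch (z : ℤ) : RatFunc ℚ := if 0 ≤ z then (qPoch z.toNat)⁻¹ else 0

theorem invPoch_of_neg {z : ℤ} (hz : z < 0) : invPoch z = 0 := if_neg (by omega)

theorem invPoch_natCast (n : ℕ) : invPoch n = (qPoch n)⁻¹ := by simp [invPoch]

@[simp] theorem invPoch_zero : invPoch 0 = 1 := by simp [invPoch]

/-- At `z = -1` the factor `1 - q^0` vanishes, so the recursion crosses the boundary and holds for
every integer. -/
theorem invPoch_eq_mul (z : ℤ) : invPoch z = (1 - q ^ (z + 1)) * invPoch (z + 1) := by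
  rcases lt_trichotomy z (-1) with h | rfl | h
  · rw [invPoch_of_neg (by omega), invPoch_of_neg (by omega), mul_zero]
  · simp [invPoch]
  · obtain ⟨n, rfl⟩ := Int.eq_ofNat_of_zero_le (show 0 ≤ z by omega)
    have h1 : 1 - q ^ (n + 1) ≠ 0 := one_sub_q_pow_ne_zero n.succ_pos
    have h2 : ((n : ℤ) + 1) = ((n + 1 : ℕ) : ℤ) := by push_cast; ring
    rw [h2, invPoch_natCast, invPoch_natCast, qPoch_succ, zpow_natCast]
    have := qPoch_ne_zero n
    field_simp

theorem gauss_eq (P N : ℤ) : gauss P N = qPoch P.toNat * (invPoch N * invPoch (P - N)) := by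
  unfold gauss invPoch
  split_ifs <;> first | omega | simp [div_eq_mul_inv, mul_comm]

theorem gauss_eq_zero {P N : ℤ} (h : N < 0 ∨ P < N) : gauss P N = 0 := if_neg (by omega)

theorem gauss_sub (P N : ℤ) : gauss P (P - N) = gauss P N := by
  rw [gauss_eq, gauss_eq, sub_sub_cancel, mul_comm (invPoch N)]

@[simp] theorem gauss_zero_right (n : ℕ) : gauss n 0 = 1 := by
  simp [gauss, qPoch_ne_zero]

@[simp] theorem gauss_self (n : ℕ) : gauss n n = 1 := by
  simp [gauss, qPoch_ne_zero]

/-- The excluded case is a genuine exception: there the left side is `[0; 0] = 1` and both terms on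
the right are `0`. -/
theorem gauss_pascal {P N : ℤ} (h : ¬(P = -1 ∧ N = -1)) :
    gauss (P + 1) (N + 1) = gauss P N + q ^ (N + 1) * gauss P (N + 1) := by
  rcases lt_or_ge P 0 with hP | hP
  · rw [gauss_eq_zero (by omega : N < 0 ∨ P < N), gauss_eq_zero (by omega : N + 1 < 0 ∨ P < N + 1),
      gauss_eq_zero (by omega)]
    simp
  · obtain ⟨n, rfl⟩ := Int.eq_ofNat_of_zero_le hP
    have h2 : ((n : ℤ) + 1).toNat = n + 1 := by omega
    rw [gauss_eq, gauss_eq, gauss_eq, h2, Int.toNat_natCast, qPoch_succ,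
      invPoch_eq_mul N, show (n : ℤ) - (N + 1) = n - N - 1 by ring, invPoch_eq_mul (n - N - 1)]
    have e1 : (n : ℤ) + 1 - (N + 1) = n - N := by ring
    rw [e1, sub_add_cancel]
    have e2 : q ^ (n + 1) = q ^ (N + 1) * q ^ ((n : ℤ) - N) := by
      rw [← zpow_add₀ q_ne_zero, ← zpow_natCast]; congr 1; push_cast; ring
    rw [e2]; ring

theorem gauss_pascal' {P N : ℤ} (h : ¬(P = -1 ∧ N = -1)) :
    gauss (P + 1) (N + 1) = gauss P (N + 1) + q ^ (P - N) * gauss P N := by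
  rcases eq_or_ne P (-1) with rfl | hP
  · rw [gauss_eq_zero (by omega), gauss_eq_zero (by omega), gauss_eq_zero (by omega)]; simp
  · rw [← gauss_sub (P + 1), show P + 1 - (N + 1) = P - N - 1 + 1 by ring, gauss_pascal (by omega),
      show P - N - 1 + 1 = P - N by ring, show P - N - 1 = P - (N + 1) by ring, gauss_sub, gauss_sub]

/-! ### The q-Vandermonde and q-Saalschütz summations -/

/-- The `q`-Vandermonde convolution. -/
theorem gauss_add_eq_sum (m x n : ℕ) :
    gauss ((x : ℤ) + m) n = ∑ j ∈ Finset.range (n + 1),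
      q ^ (((m : ℤ) - j) * (n - j)) * (gauss m j * gauss x (n - j)) := by
  induction m generalizing n with
  | zero =>
    rw [Finset.sum_eq_single 0]
    · have := gauss_self 0
      simp_all
    · intro j _ hj
      rw [gauss_eq_zero (P := ((0 : ℕ) : ℤ)) (by omega)]; simp
    · simp
  | succ m ih =>
    have key : ∀ n : ℕ, ∑ j ∈ Finset.range (n + 1),
        q ^ ((((m + 1 : ℕ) : ℤ) - j) * (n - j)) * (q ^ (j : ℤ) * gauss m j * gauss x (n - j)) =
        q ^ (n : ℤ) * gauss ((x : ℤ) + m) n := by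
      intro n
      rw [ih, Finset.mul_sum]
      refine Finset.sum_congr rfl fun j _ => ?_
      have : q ^ ((((m + 1 : ℕ) : ℤ) - j) * (n - j)) * q ^ (j : ℤ) =
          q ^ (n : ℤ) * q ^ (((m : ℤ) - j) * (n - j)) := by
        rw [← zpow_add₀ q_ne_zero, ← zpow_add₀ q_ne_zero]; congr 1; push_cast; ring
      linear_combination (gauss m j * gauss x (n - j)) * this
    have pas : ∀ j : ℕ, gauss ((m + 1 : ℕ) : ℤ) j =
        gauss m ((j : ℤ) - 1) + q ^ (j : ℤ) * gauss m j := by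
      intro j
      have := gauss_pascal (P := m) (N := (j : ℤ) - 1) (by omega)
      simpa using this
    simp_rw [pas, add_mul, mul_add, Finset.sum_add_distrib]
    rw [key]
    have h0 := gauss_pascal (P := (x : ℤ) + m) (N := (n : ℤ) - 1) (by omega)
    rw [sub_add_cancel] at h0
    rw [show (x : ℤ) + ((m + 1 : ℕ) : ℤ) = (x : ℤ) + m + 1 by push_cast; ring, h0]
    congr 1
    cases n with
    | zero => simp [gauss_eq_zero]
    | succ n =>
      rw [Finset.sum_range_succ', gauss_eq_zero (N := ((0 : ℕ) : ℤ) - 1) (by omega)]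
      rw [show ((n + 1 : ℕ) : ℤ) - 1 = n by push_cast; ring, ih]
      simp only [zero_mul, mul_zero, add_zero]
      refine Finset.sum_congr rfl fun j _ => ?_
      push_cast
      congr 2
      · ring
      · congr 1; ring
      · congr 1; ring

/-- The `q`-Vandermonde convolution, with the other choice of exponents. -/
theorem gauss_add_eq_sum' (m x n : ℕ) :
    gauss ((x : ℤ) + m) n = ∑ j ∈ Finset.range (n + 1),
      q ^ ((j : ℤ) * (x - n + j)) * (gauss m j * gauss x (n - j)) := by
  rw [add_comm, gauss_add_eq_sum, ← Finset.sum_range_reflect]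
  refine Finset.sum_congr rfl fun j hj => ?_
  have hj' : j ≤ n := by simpa [Nat.lt_succ_iff] using hj
  have e : ((n + 1 - 1 - j : ℕ) : ℤ) = n - j := by omega
  rw [e, mul_comm (gauss _ _)]
  congr 2
  · ring
  · congr 1; ring

theorem gauss_mul_gauss {n k j : ℤ} :
    gauss n k * gauss k j = gauss n j * gauss (n - j) (k - j) := by
  rcases lt_or_ge j 0 with hj | hj
  · rw [gauss_eq_zero (N := j) (by omega), gauss_eq_zero (N := j) (by omega)]; simp
  rcases lt_or_ge k j with hk | hk
  · rw [gauss_eq_zero (N := j) (by omega), gauss_eq_zero (N := k - j) (by omega)]; simp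
  rcases lt_or_ge n k with hn | hn
  · rw [gauss_eq_zero (N := k) (by omega), gauss_eq_zero (N := k - j) (by omega)]; simp
  · simp only [gauss, if_pos (show 0 ≤ k ∧ k ≤ n by omega), if_pos (show 0 ≤ j ∧ j ≤ k by omega),
      if_pos (show 0 ≤ j ∧ j ≤ n by omega), if_pos (show 0 ≤ k - j ∧ k - j ≤ n - j by omega)]
    have := qPoch_ne_zero
    rw [show n - j - (k - j) = n - k by ring]
    field_simp [this]

theorem gauss_add_eq_sum_range (m x n : ℕ) :
    gauss ((x : ℤ) + m) n = ∑ j ∈ Finset.range (m + 1),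
      q ^ (((m : ℤ) - j) * (n - j)) * (gauss m j * gauss x (n - j)) := by
  rw [gauss_add_eq_sum]
  have h1 := Finset.sum_subset (s₁ := Finset.range (n + 1)) (s₂ := Finset.range (m + n + 1))
    (f := fun j : ℕ => q ^ (((m : ℤ) - j) * (n - j)) * (gauss m j * gauss x (n - j)))
    (Finset.range_subset_range.2 (by omega)) (fun j _ hj => by
      rw [Finset.mem_range] at hj
      rw [gauss_eq_zero (P := x) (by omega)]; simp)
  have h2 := Finset.sum_subset (s₁ := Finset.range (m + 1)) (s₂ := Finset.range (m + n + 1))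
    (f := fun j : ℕ => q ^ (((m : ℤ) - j) * (n - j)) * (gauss m j * gauss x (n - j)))
    (Finset.range_subset_range.2 (by omega)) (fun j _ hj => by
      rw [Finset.mem_range] at hj
      rw [gauss_eq_zero (P := m) (by omega)]; simp)
  rw [h1, h2]

/-- A form of the `q`-Saalschütz summation. -/
theorem sum_gauss_mul_gauss_mul_gauss (x y n m : ℕ) :
    ∑ k ∈ Finset.range (m + 1), q ^ (((n : ℤ) - k) * (m - k)) *
      (gauss ((x : ℤ) + y + k) k * gauss x (n - k) * gauss y (m - k)) =
      gauss ((x : ℤ) + m) n * gauss ((y : ℤ) + n) m := by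
  -- Vandermonde expands `[x+y+k; k]` along `(x-n+k) + (y+n)`; `gauss_mul_gauss` then makes the
  -- factor in `x` independent of `k`.
  have h1 : ∀ k ∈ Finset.range (m + 1), q ^ (((n : ℤ) - k) * (m - k)) *
      (gauss ((x : ℤ) + y + k) k * gauss x (n - k) * gauss y (m - k)) =
      ∑ j ∈ Finset.range (k + 1), q ^ (((n : ℤ) - k) * (m - k) + (k - j) * (y + n - j)) *
        (gauss ((y : ℤ) + n) j * (gauss x (n - j) * gauss ((n : ℤ) - j) (n - k)) *
          gauss y (m - k)) := by
    intro k _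
    -- Vandermonde needs `x - n + k` to be a natural number; otherwise `[x; n-j]` vanishes for all
    -- `j ≤ k`, hence so do both sides.
    rcases lt_or_ge ((x : ℤ) - n + k) 0 with hx | hx
    · rw [gauss_eq_zero (P := x) (by omega)]
      simp only [mul_zero, zero_mul]
      refine (Finset.sum_eq_zero fun j hj => ?_).symm
      rcases lt_or_ge ((x : ℤ) - n + j) 0 with hx | hx
      · rw [gauss_eq_zero (P := x) (by omega)]; simp
      · have := Finset.mem_range.1 hj; omega
    · obtain ⟨z, hz⟩ := Int.eq_ofNat_of_zero_le hx
      have := gauss_add_eq_sum' z (y + n) k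
      rw [show ((y + n : ℕ) : ℤ) + (z : ℤ) = x + y + k by push_cast; omega,
        ← Finset.sum_range_reflect] at this
      rw [this, Finset.sum_mul, Finset.sum_mul, Finset.mul_sum]
      refine Finset.sum_congr rfl fun j hj => ?_
      have hj' : j ≤ k := by simpa [Nat.lt_succ_iff] using hj
      have e : ((k + 1 - 1 - j : ℕ) : ℤ) = k - j := by omega
      rw [e, zpow_add₀ q_ne_zero, show (k : ℤ) - (k - j) = j by ring, ← hz, gauss_mul_gauss,
        show (x : ℤ) - (n - k) = x - n + k by ring, show (n : ℤ) - j - (n - k) = k - j by ring,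
        show ((y + n : ℕ) : ℤ) - k + (k - j) = y + n - j by push_cast; ring]
      push_cast
      ring
  -- With the sums exchanged, the inner one over `k` is a Vandermonde sum, and so is the outer one
  -- over `j`.
  rw [Finset.sum_congr rfl h1, Finset.sum_comm' (t' := Finset.range (m + 1))
    (s' := fun j => Finset.Ico j (m + 1)) (by intro a b; simp; omega),
    gauss_add_eq_sum_range, Finset.sum_mul]
  refine Finset.sum_congr rfl fun j hj => ?_
  have hj' : j ≤ m := by simpa [Nat.lt_succ_iff] using hj
  rw [Finset.sum_Ico_eq_sum_range]
  rcases lt_or_ge n j with hn | hn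
  · rw [gauss_eq_zero (N := (n : ℤ) - j) (by omega)]; simp
  have h2 : gauss (m : ℤ) j * gauss ((y : ℤ) + n) m =
      gauss ((y : ℤ) + n) j * gauss ((y : ℤ) + n - j) (m - j) := by
    rw [mul_comm, gauss_mul_gauss]
  have h3 := gauss_add_eq_sum' (n - j) y (m - j)
  rw [Nat.cast_sub hn, Nat.cast_sub hj', show (y : ℤ) + (n - j) = y + n - j by ring] at h3
  rw [show ∀ A B C D : RatFunc ℚ, A * (B * C) * D = A * C * (B * D) from fun _ _ _ _ => by ring,
    h2, h3, Finset.mul_sum, Finset.mul_sum, show m + 1 - j = m - j + 1 by omega]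
  refine Finset.sum_congr rfl fun i hi => ?_
  have e : q ^ (((n : ℤ) - ((j + i : ℕ) : ℤ)) * (m - ((j + i : ℕ) : ℤ)) +
      (((j + i : ℕ) : ℤ) - j) * (y + n - j)) =
      q ^ (((m : ℤ) - j) * (n - j)) * q ^ ((i : ℤ) * (y - (m - j) + i)) := by
    rw [← zpow_add₀ q_ne_zero]; congr 1; push_cast; ring
  rw [e, show ((n : ℤ) - ((j + i : ℕ) : ℤ)) = n - j - i by push_cast; ring, gauss_sub,
    show ((m : ℤ) - ((j + i : ℕ) : ℤ)) = m - j - i by push_cast; ring]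
  ring

/-- The sum is symmetric under `(x, n) ↔ (y, m)`, so it may be cut off at either `n` or `m`. -/
theorem sum_gauss_mul_gauss_mul_gauss_of_le {x y n m K : ℕ} (hK : n ≤ K ∨ m ≤ K) :
    ∑ k ∈ Finset.range (K + 1), q ^ (((n : ℤ) - k) * (m - k)) *
      (gauss ((x : ℤ) + y + k) k * gauss x (n - k) * gauss y (m - k)) =
      gauss ((x : ℤ) + m) n * gauss ((y : ℤ) + n) m := by
  rcases hK with hK | hK
  · have := sum_gauss_mul_gauss_mul_gauss y x m n
    rw [mul_comm (gauss _ _), ← this]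
    symm
    refine (Finset.sum_subset (Finset.range_subset_range.2 (by omega)) fun j _ hj => ?_).trans
      (Finset.sum_congr rfl fun j _ => ?_)
    · rw [Finset.mem_range] at hj
      rw [gauss_eq_zero (P := x) (by omega)]; simp
    · rw [mul_comm ((m : ℤ) - j), add_comm (y : ℤ)]; ring
  · rw [← sum_gauss_mul_gauss_mul_gauss x y n m]
    symm
    refine Finset.sum_subset (Finset.range_subset_range.2 (by omega)) fun j _ hj => ?_
    rw [Finset.mem_range] at hj
    rw [gauss_eq_zero (P := y) (by omega)]; simp

/-- The limit of the `q`-Saalschütz summation used at infinite width. -/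
theorem sum_invPoch_mul_invPoch_mul_invPoch (n m : ℕ) :
    ∑ k ∈ Finset.range (n + 1), q ^ (((n : ℤ) - k) * (m - k)) *
      (invPoch k * invPoch (n - k) * invPoch (m - k)) = invPoch n * invPoch m := by
  -- Multiplication by `(q)_n (q)_m` makes the right side `1`. Pascal in `n` then splits the sum
  -- into pieces with values `q^m` and `1 - q^m`.
  suffices h : ∀ n m : ℕ, ∑ k ∈ Finset.range (n + 1), q ^ (((n : ℤ) - k) * (m - k)) *
      (gauss n k * (qPoch m * invPoch (m - k))) = 1 by
    have h1 := qPoch_ne_zero n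
    have h2 := qPoch_ne_zero m
    rw [← mul_right_inj' h1, ← mul_right_inj' h2, invPoch_natCast, invPoch_natCast]
    rw [show qPoch m * (qPoch n * ((qPoch n)⁻¹ * (qPoch m)⁻¹)) = 1 by field_simp, ← h n m,
      Finset.mul_sum, Finset.mul_sum]
    refine Finset.sum_congr rfl fun k _ => ?_
    rw [gauss_eq, Int.toNat_natCast]
    ring
  clear n m
  intro n
  induction n with
  | zero =>
    intro m
    have := qPoch_ne_zero m
    have := gauss_self 0
    simp_all [invPoch_natCast]
  | succ n ih =>
    intro m
    have pas : ∀ j : ℕ, gauss ((n + 1 : ℕ) : ℤ) j =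
        q ^ (j : ℤ) * gauss n j + gauss n ((j : ℤ) - 1) := by
      intro j
      have := gauss_pascal (P := n) (N := (j : ℤ) - 1) (by omega)
      rw [add_comm (q ^ _ * _)]
      simpa using this
    simp_rw [pas, add_mul, mul_add, Finset.sum_add_distrib]
    rw [Finset.sum_range_succ, Finset.sum_range_succ' (n := n + 1),
      gauss_eq_zero (N := ((0 : ℕ) : ℤ) - 1) (by omega),
      gauss_eq_zero (N := ((n + 1 : ℕ) : ℤ)) (by omega)]
    simp only [zero_mul, mul_zero, add_zero]
    have e1 : ∑ j ∈ Finset.range (n + 1), q ^ ((((n + 1 : ℕ) : ℤ) - j) * (m - j)) *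
        (q ^ (j : ℤ) * gauss n j * (qPoch m * invPoch (m - j))) = q ^ (m : ℤ) := by
      rw [← mul_one (q ^ (m : ℤ)), ← ih m, Finset.mul_sum]
      refine Finset.sum_congr rfl fun j _ => ?_
      have : q ^ ((((n + 1 : ℕ) : ℤ) - j) * (m - j)) * q ^ (j : ℤ) =
          q ^ (m : ℤ) * q ^ (((n : ℤ) - j) * (m - j)) := by
        rw [← zpow_add₀ q_ne_zero, ← zpow_add₀ q_ne_zero]; congr 1; push_cast; ring
      linear_combination (gauss n j * (qPoch m * invPoch (m - j))) * this
    rw [e1]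
    cases m with
    | zero =>
      rw [Finset.sum_eq_zero fun j _ => ?_]
      · simp
      · rw [invPoch_of_neg (by push_cast; omega)]; simp
    | succ m =>
      have e2 : ∑ j ∈ Finset.range (n + 1),
          q ^ ((((n + 1 : ℕ) : ℤ) - ((j + 1 : ℕ) : ℤ)) * (((m + 1 : ℕ) : ℤ) - ((j + 1 : ℕ) : ℤ))) *
          (gauss n (((j + 1 : ℕ) : ℤ) - 1) *
            (qPoch (m + 1) * invPoch (((m + 1 : ℕ) : ℤ) - ((j + 1 : ℕ) : ℤ)))) =
          1 - q ^ (m + 1) := by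
        trans (1 - q ^ (m + 1)) * ∑ k ∈ Finset.range (n + 1),
          q ^ (((n : ℤ) - k) * (m - k)) * (gauss n k * (qPoch m * invPoch (m - k)))
        swap
        · rw [ih, mul_one]
        rw [Finset.mul_sum]
        refine Finset.sum_congr rfl fun j _ => ?_
        rw [qPoch_succ]
        push_cast
        rw [add_sub_add_right_eq_sub, add_sub_add_right_eq_sub, add_sub_cancel_right]
        ring
      rw [e2, zpow_natCast]; ring

/-! ### Products of two Gaussian polynomials and the Burge transform -/

/-- The product `[L + M + a - b; L + a] [L + M - a + b; L - a]`, or its limit up to a factor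
`(q)_∞` if `L` or `M` is infinite. -/
noncomputable def gaussPair (L M : ℕ∞) (a b : ℤ) : RatFunc ℚ :=
  if L = ⊤ then invPoch (M.toNat - b) * invPoch (M.toNat + b)
  else if M = ⊤ then invPoch (L.toNat - a) * invPoch (L.toNat + a)
  else gauss (L.toNat + M.toNat + a - b) (L.toNat + a) *
    gauss (L.toNat + M.toNat - a + b) (L.toNat - a)

theorem gaussPair_top_left (M : ℕ) (a b : ℤ) :
    gaussPair ⊤ M a b = invPoch (M - b) * invPoch (M + b) := by simp [gaussPair]

theorem gaussPair_top_right (L : ℕ) (a b : ℤ) :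
    gaussPair L ⊤ a b = invPoch (L - a) * invPoch (L + a) := by simp [gaussPair]

theorem gaussPair_natCast (L M : ℕ) (a b : ℤ) :
    gaussPair L M a b = gauss (L + M + a - b) (L + a) * gauss (L + M - a + b) (L - a) := by
  simp [gaussPair]

theorem gaussPair_neg (L M : ℕ∞) (a b : ℤ) : gaussPair L M (-a) (-b) = gaussPair L M a b := by
  unfold gaussPair
  split_ifs
  · rw [mul_comm]; simp [sub_eq_add_neg]
  · rw [mul_comm]; simp [sub_eq_add_neg]
  · rw [mul_comm]; simp [sub_eq_add_neg]

/-- Both Gaussians are complemented. With two infinite bounds `gaussPair` only has a default value,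
which is why "not both infinite" accompanies the bounds throughout. -/
theorem gaussPair_swap {L M : ℕ∞} (h : L ≠ ⊤ ∨ M ≠ ⊤) (a b : ℤ) :
    gaussPair L M a b = gaussPair M L b a := by
  induction L using ENat.recTopCoe with
  | top =>
    induction M using ENat.recTopCoe with
    | top => simp at h
    | coe M => rw [gaussPair_top_left, gaussPair_top_right]
  | coe L =>
    induction M using ENat.recTopCoe with
    | top => rw [gaussPair_top_left, gaussPair_top_right]
    | coe M =>
      rw [gaussPair_natCast, gaussPair_natCast, mul_comm, ← gauss_sub, mul_comm,
        ← gauss_sub ((L : ℤ) + M + a - b), mul_comm]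
      congr 2 <;> ring

theorem gaussPair_eq_zero_left {L : ℕ} {M : ℕ∞} {a b : ℤ} (h : L < |a|) :
    gaussPair L M a b = 0 := by
  have h1 : (L : ℤ) - a < 0 ∨ (L : ℤ) + a < 0 := by
    rcases lt_abs.1 h with h | h
    · left; omega
    · right; omega
  induction M using ENat.recTopCoe with
  | top =>
    rw [gaussPair_top_right]
    rcases h1 with h1 | h1 <;> rw [invPoch_of_neg h1] <;> simp
  | coe M =>
    rw [gaussPair_natCast]
    rcases h1 with h1 | h1 <;> rw [gauss_eq_zero (Or.inl h1)] <;> simp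

theorem gaussPair_eq_zero_right {L : ℕ∞} {M : ℕ} {a b : ℤ} (h : M < |b|) :
    gaussPair L M a b = 0 := by
  rw [gaussPair_swap (Or.inr (by simp))]
  exact gaussPair_eq_zero_left h

/-- The coefficient `[2L + M - i; M - i]` of the Burge transform, or its limit up to a factor
`(q)_∞` if `L` or `M` is infinite. -/
noncomputable def burgeCoeff (L M : ℕ∞) (i : ℕ) : RatFunc ℚ :=
  if L = ⊤ then invPoch (M.toNat - i)
  else if M = ⊤ then invPoch (2 * L.toNat)
  else gauss (2 * L.toNat + M.toNat - i) (M.toNat - i)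

theorem burgeCoeff_top_left (M i : ℕ) : burgeCoeff ⊤ M i = invPoch (M - i) := by simp [burgeCoeff]

theorem burgeCoeff_top_right (L i : ℕ) : burgeCoeff L ⊤ i = invPoch (2 * L) := by simp [burgeCoeff]

theorem burgeCoeff_natCast (L M i : ℕ) :
    burgeCoeff L M i = gauss (2 * L + M - i) (M - i) := by simp [burgeCoeff]

/-- The range of summation of the Burge transform. -/
noncomputable def burgeRange (L M : ℕ∞) : Finset ℕ := Finset.range ((min L M).toNat + 1)

theorem mem_burgeRange {L M : ℕ∞} (h : L ≠ ⊤ ∨ M ≠ ⊤) {i : ℕ} :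
    i ∈ burgeRange L M ↔ (i : ℕ∞) ≤ L ∧ (i : ℕ∞) ≤ M := by
  have h1 : min L M ≠ ⊤ := by
    rcases h with h | h
    · exact ne_top_of_le_ne_top h (min_le_left _ _)
    · exact ne_top_of_le_ne_top h (min_le_right _ _)
  rw [burgeRange, Finset.mem_range, Nat.lt_succ_iff, ← le_min_iff, ← ENat.natCast_le_natCast,
    ENat.natCast_toNat h1]

/-- The Burge transform at `L = ∞`: the limiting Saalschütz sum at `(M - b, M + b)`, with summation
index `M - i`. -/
theorem sum_invPoch_eq (M b : ℕ) :
    ∑ i ∈ Finset.range (M + 1), q ^ i ^ 2 * (invPoch (M - i) *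
      (invPoch ((i : ℤ) - b) * invPoch (i + b))) =
      q ^ ((b : ℤ) ^ 2) * (invPoch ((M : ℤ) - b) * invPoch (M + b)) := by
  rcases lt_or_ge M b with h | h
  · rw [invPoch_of_neg (by omega : (M : ℤ) - b < 0), Finset.sum_eq_zero fun i hi => ?_]
    · simp
    · have := Finset.mem_range.1 hi
      rw [invPoch_of_neg (by omega : (i : ℤ) - b < 0)]; simp
  · have h1 := sum_invPoch_mul_invPoch_mul_invPoch (M - b) (M + b)
    rw [Nat.cast_sub h, Nat.cast_add] at h1
    rw [← h1, Finset.mul_sum, ← Finset.sum_range_reflect]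
    symm
    refine (Finset.sum_subset (Finset.range_subset_range.2 (by omega : _ ≤ M + 1))
      fun j _ hj => ?_).trans (Finset.sum_congr rfl fun j hj => ?_)
    · rw [Finset.mem_range] at hj
      rw [invPoch_of_neg (by omega : (M : ℤ) - b - j < 0)]; simp
    · have hj' : j ≤ M := by simpa [Nat.lt_succ_iff] using hj
      have e : ((M + 1 - 1 - j : ℕ) : ℤ) = M - j := by omega
      rw [e, ← zpow_natCast q ((M + 1 - 1 - j) ^ 2), Nat.cast_pow, e,
        show (M : ℤ) - (M - j) = j by ring, show (M : ℤ) - j - b = M - b - j by ring,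
        show (M : ℤ) - j + b = M + b - j by ring]
      have : q ^ ((b : ℤ) ^ 2) * q ^ (((M : ℤ) - b - j) * (M + b - j)) = q ^ (((M : ℤ) - j) ^ 2) := by
        rw [← zpow_add₀ q_ne_zero]; congr 1; ring
      rw [← this]; ring

/-- The Burge transform at `M = ∞`. The bounds `L - i` and `i` add up to `L`, so the upper entries
do not depend on `i` and Vandermonde suffices. -/
theorem sum_gaussPair_top (L a b : ℕ) :
    ∑ i ∈ Finset.range (L + 1), q ^ i ^ 2 * (invPoch (2 * L) *
      gaussPair ((L - i : ℕ) : ℕ∞) i a b) =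
      q ^ ((b : ℤ) ^ 2) * gaussPair L ⊤ (a + b) b := by
  rw [gaussPair_top_right]
  rcases lt_or_ge L (a + b) with h | h
  · rw [invPoch_of_neg (by omega : (L : ℤ) - (a + b) < 0), Finset.sum_eq_zero fun i hi => ?_]
    · simp
    · have hi' := Finset.mem_range.1 hi
      rcases lt_or_ge i b with h1 | h1
      · rw [gaussPair_eq_zero_right (by rw [Nat.abs_cast]; omega)]; simp
      · rw [gaussPair_eq_zero_left (by rw [Nat.abs_cast]; omega)]; simp
  · have h1 := gauss_add_eq_sum' (L + a - b) (L + b - a) (L - a - b)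
    have e1 : ((L + b - a : ℕ) : ℤ) = L + b - a := by omega
    have e2 : ((L + a - b : ℕ) : ℤ) = L + a - b := by omega
    have e3 : ((L - a - b : ℕ) : ℤ) = L - a - b := by omega
    rw [e1, e2, e3, show (L : ℤ) + b - a + (L + a - b) = ((2 * L : ℕ) : ℤ) by push_cast; ring,
      gauss_eq, Int.toNat_natCast, show ((2 * L : ℕ) : ℤ) - (L - a - b) = L + (a + b) by
        push_cast; ring, show (L : ℤ) - a - b = L - (a + b) by ring] at h1
    have h2 : invPoch (L - (a + b)) * invPoch (L + (a + b)) = invPoch ((2 * L : ℕ) : ℤ) *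
        (qPoch (2 * L) * (invPoch (L - (a + b)) * invPoch (L + (a + b)))) := by
      rw [invPoch_natCast]
      have := qPoch_ne_zero (2 * L)
      field_simp
    rw [h2, h1, Finset.mul_sum, Finset.mul_sum]
    symm
    rw [show L - a - b + 1 = L - a + 1 - b by omega]
    trans ∑ i ∈ Finset.Ico b (L - a + 1), q ^ i ^ 2 * (invPoch (2 * L) *
      gaussPair ((L - i : ℕ) : ℕ∞) i a b)
    · rw [Finset.sum_Ico_eq_sum_range]
      refine Finset.sum_congr rfl fun j hj => ?_
      rw [Finset.mem_range] at hj
      have e : ((L - (b + j) : ℕ) : ℤ) = L - (b + j) := by omega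
      rw [gaussPair_natCast, e, ← gauss_sub _ ((L : ℤ) - (b + j) + a)]
      push_cast
      have e5 : q ^ (b + j) ^ 2 = q ^ ((b : ℤ) ^ 2) *
          q ^ ((j : ℤ) * (L + b - a - (L - (a + b)) + j)) := by
        rw [← zpow_add₀ q_ne_zero, ← zpow_natCast]; congr 1; push_cast; ring
      rw [e5, show (L : ℤ) - (b + j) + (b + j) + a - b = L + a - b by ring,
        show (L : ℤ) - (b + j) + (b + j) - a + b = L + b - a by ring,
        show (L : ℤ) + a - b - (L - (b + j) + a) = j by ring,
        show (L : ℤ) - (b + j) - a = L - (a + b) - j by ring]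
      ring
    · refine Finset.sum_subset (fun i hi => ?_) fun i hi hi' => ?_
      · rw [Finset.mem_Ico] at hi; rw [Finset.mem_range]; omega
      · rw [Finset.mem_Ico] at hi'; rw [Finset.mem_range] at hi
        rcases lt_or_ge i b with h1 | h1
        · rw [gaussPair_eq_zero_right (by rw [Nat.abs_cast]; omega)]; simp
        · rw [gaussPair_eq_zero_left (by rw [Nat.abs_cast]; omega)]; simp

/-- Saalschütz with `x = L+a-b`, `y = L+b-a`, `n = M-b`, `m = M+b` and index `M - i`. -/
theorem sum_gaussPair_natCast (L M a b : ℕ) :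
    ∑ i ∈ Finset.range (min L M + 1), q ^ i ^ 2 * (burgeCoeff L M i *
      gaussPair ((L - i : ℕ) : ℕ∞) i a b) =
      q ^ ((b : ℤ) ^ 2) * gaussPair L M (a + b) b := by
  rcases lt_or_ge M b with hM | hM
  · rw [gaussPair_eq_zero_right (by rw [Nat.abs_cast]; omega), Finset.sum_eq_zero fun i hi => ?_]
    · simp
    · rw [Finset.mem_range] at hi
      rw [gaussPair_eq_zero_right (by rw [Nat.abs_cast]; omega)]; simp
  -- A non-zero summand needs `i ≥ b` and `L - i ≥ a`. For `a`, `b` of opposite signs this would not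
  -- match the vanishing of the right side, whence the sign condition in the general transform.
  rcases lt_or_ge L (a + b) with hL | hL
  · rw [gaussPair_eq_zero_left (by rw [← Nat.cast_add, Nat.abs_cast]; omega),
      Finset.sum_eq_zero fun i hi => ?_]
    · simp
    · rw [Finset.mem_range] at hi
      rcases lt_or_ge i b with h1 | h1
      · rw [gaussPair_eq_zero_right (by rw [Nat.abs_cast]; omega)]; simp
      · rw [gaussPair_eq_zero_left (by rw [Nat.abs_cast]; omega)]; simp
  have h1 := sum_gauss_mul_gauss_mul_gauss_of_le (x := L + a - b) (y := L + b - a) (n := M - b)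
    (m := M + b) (K := M) (by omega)
  have e1 : ((L + b - a : ℕ) : ℤ) = L + b - a := by omega
  have e2 : ((L + a - b : ℕ) : ℤ) = L + a - b := by omega
  have e3 : ((M - b : ℕ) : ℤ) = M - b := by omega
  rw [e1, e2, e3, Nat.cast_add] at h1
  have h2 : gaussPair L M (a + b) b = gauss ((L : ℤ) + a - b + (M + b)) (M - b) *
      gauss ((L : ℤ) + b - a + (M - b)) (M + b) := by
    rw [gaussPair_natCast, ← gauss_sub, ← gauss_sub _ ((L : ℤ) - (a + b))]
    congr 2 <;> ring
  rw [h2, ← h1, Finset.mul_sum, ← Finset.sum_range_reflect _ (M + 1)]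
  refine (Finset.sum_congr rfl fun i hi => ?_).trans (Finset.sum_subset
    (Finset.range_subset_range.2 (by omega : min L M + 1 ≤ M + 1)) fun i hi hi' => ?_)
  · rw [Finset.mem_range] at hi
    have e : ((M + 1 - 1 - i : ℕ) : ℤ) = M - i := by omega
    have e' : ((L - i : ℕ) : ℤ) = L - i := by omega
    rw [e, gaussPair_natCast, burgeCoeff_natCast, e', ← gauss_sub _ ((L : ℤ) - i + a),
      ← gauss_sub _ ((L : ℤ) - i - a)]
    have e5 : q ^ i ^ 2 = q ^ ((b : ℤ) ^ 2) *
        q ^ (((M : ℤ) - b - (M - i)) * (M + b - (M - i))) := by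
      rw [← zpow_add₀ q_ne_zero, ← zpow_natCast]; congr 1; push_cast; ring
    rw [e5, mul_assoc (q ^ ((b : ℤ) ^ 2))]
    congr 2
    rw [mul_assoc]
    congr 2
    · ring
    · congr 1 <;> ring
    · congr 1 <;> ring
  · rw [Finset.mem_range] at hi hi'
    have e : ((M + 1 - 1 - i : ℕ) : ℤ) = M - i := by omega
    rw [e, gauss_eq_zero (P := (L : ℤ) + b - a) (by omega)]
    simp

/-- The Burge transform. -/
theorem sum_burgeCoeff_mul_gaussPair {L M : ℕ∞} (h : L ≠ ⊤ ∨ M ≠ ⊤) {a b : ℤ} (hab : 0 ≤ a * b) :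
    ∑ i ∈ burgeRange L M, q ^ i ^ 2 * (burgeCoeff L M i * gaussPair (L - i) i a b) =
      q ^ (b ^ 2) * gaussPair L M (a + b) b := by
  wlog hpos : 0 ≤ a ∧ 0 ≤ b generalizing a b
  · have hneg : 0 ≤ -a ∧ 0 ≤ -b := by
      rcases mul_nonneg_iff.1 hab with h | h
      · exact absurd h hpos
      · omega
    have := this (a := -a) (b := -b) (by simpa using hab) hneg
    rw [← neg_add] at this
    simpa only [gaussPair_neg, neg_sq] using this
  obtain ⟨a, rfl⟩ := Int.eq_ofNat_of_zero_le hpos.1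
  obtain ⟨b, rfl⟩ := Int.eq_ofNat_of_zero_le hpos.2
  induction L using ENat.recTopCoe with
  | top =>
    induction M using ENat.recTopCoe with
    | top => simp at h
    | coe M =>
      rw [gaussPair_top_left, ← sum_invPoch_eq]
      simp only [burgeRange, min_top_left, ENat.toNat_natCast, burgeCoeff_top_left, ENat.top_sub_natCast,
        gaussPair_top_left]
  | coe L =>
    induction M using ENat.recTopCoe with
    | top =>
      rw [← sum_gaussPair_top]
      simp only [burgeRange, min_top_right, ENat.toNat_natCast, burgeCoeff_top_right, ENat.natCast_sub]
    | coe M =>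
      rw [← sum_gaussPair_natCast]
      have e : (min (L : ℕ∞) M).toNat = min L M := by
        rw [← Nat.mono_cast.map_min, ENat.toNat_natCast]
      simp only [burgeRange, ENat.natCast_sub, e]

/-! ### Bosonic sums -/

theorem finite_setOf_abs_le {P : ℤ} (hP : 0 < P) (β : ℤ) (n : ℤ) :
    {k : ℤ | |k * P + β| ≤ n}.Finite := by
  refine (Set.finite_Icc (-(n + |β|)) (n + |β|)).subset fun k hk => ?_
  have h1 : |k| ≤ |k * P| := by
    rw [abs_mul]
    exact le_mul_of_one_le_right (abs_nonneg k) (Int.one_le_abs hP.ne')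
  have h2 : |k * P| ≤ |k * P + β| + |β| := by
    simpa using abs_sub (k * P + β) β
  have h3 : |k * P + β| ≤ n := hk
  exact abs_le.1 (by linarith)

theorem support_gaussPair_finite {P' P : ℤ} (hP' : 0 < P') (hP : 0 < P) {L M : ℕ∞}
    (h : L ≠ ⊤ ∨ M ≠ ⊤) (e : ℤ → RatFunc ℚ) (α β : ℤ) :
    (Function.support fun k : ℤ => e k * gaussPair L M (k * P' + α) (k * P + β)).Finite := by
  rcases h with h | h
  · lift L to ℕ using h
    refine (finite_setOf_abs_le hP' α L).subset fun k hk => ?_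
    by_contra hlt
    exact hk (by simp [gaussPair_eq_zero_left (not_le.1 hlt)])
  · lift M to ℕ using h
    refine (finite_setOf_abs_le hP β M).subset fun k hk => ?_
    by_contra hlt
    exact hk (by simp [gaussPair_eq_zero_right (not_le.1 hlt)])

/-- The `k`-th summand of a bosonic sum. -/
noncomputable def bosTerm (P' P S R : ℤ) (L M : ℕ∞) (k : ℤ) : RatFunc ℚ :=
  q ^ (k ^ 2 * P * P' + k * (P' * R - P * S)) * gaussPair L M (k * P') (k * P)
    - q ^ ((k * P + R) * (k * P' + S)) * gaussPair L M (k * P' + S) (k * P + R)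

/-- A bosonic sum. -/
noncomputable def bosSum (P' P S R : ℤ) (L M : ℕ∞) : RatFunc ℚ := ∑ᶠ k, bosTerm P' P S R L M k

section

variable {P' P S R : ℤ} {L M : ℕ∞}

theorem support_fst_finite (hP' : 0 < P') (hP : 0 < P) (h : L ≠ ⊤ ∨ M ≠ ⊤) (e : ℤ → RatFunc ℚ) :
    (Function.support fun k : ℤ => e k * gaussPair L M (k * P') (k * P)).Finite := by
  simpa using support_gaussPair_finite hP' hP h e 0 0

theorem support_bosTerm_finite (hP' : 0 < P') (hP : 0 < P) (h : L ≠ ⊤ ∨ M ≠ ⊤) :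
    (Function.support (bosTerm P' P S R L M)).Finite :=
  ((support_fst_finite hP' hP h _).union (support_gaussPair_finite hP' hP h _ S R)).subset
    (Function.support_sub _ _)

theorem bosSum_eq_sub (hP' : 0 < P') (hP : 0 < P) (h : L ≠ ⊤ ∨ M ≠ ⊤) :
    bosSum P' P S R L M =
      (∑ᶠ k : ℤ, q ^ (k ^ 2 * P * P' + k * (P' * R - P * S)) * gaussPair L M (k * P') (k * P)) -
      ∑ᶠ k : ℤ, q ^ ((k * P + R) * (k * P' + S)) * gaussPair L M (k * P' + S) (k * P + R) :=
  finsum_sub_distrib (support_fst_finite hP' hP h _) (support_gaussPair_finite hP' hP h _ S R)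

theorem bosSum_swap (hP' : 0 < P') (hP : 0 < P) (h : L ≠ ⊤ ∨ M ≠ ⊤) :
    bosSum P' P S R L M = bosSum P P' R S M L := by
  rw [bosSum_eq_sub hP' hP h, bosSum_eq_sub hP hP' h.symm]
  congr 1
  · rw [← finsum_comp_equiv (Equiv.neg ℤ)]
    refine finsum_congr fun k => ?_
    rw [Equiv.neg_apply, neg_mul k P, neg_mul k P', gaussPair_neg, gaussPair_swap h]
    congr 2; ring
  · refine finsum_congr fun k => ?_
    rw [gaussPair_swap h, mul_comm (k * P + R)]

/-- The inequalities place both factors on the same side of zero for each `k`, which is the sign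
condition of the Burge transform. -/
theorem linear_mul_linear_nonneg (hP' : 0 < P') (hP : 0 < P) (hS : 0 ≤ S) (hS' : S ≤ P')
    (hR : 0 ≤ R) (hR' : R ≤ P) (k : ℤ) : 0 ≤ (k * P' + S) * (k * P + R) := by
  rcases le_or_gt 0 k with hk | hk
  · positivity
  · exact mul_nonneg_of_nonpos_of_nonpos (by nlinarith) (by nlinarith)

/-- The Burge transform is applied termwise; its factor `q^{b²}` is exactly the change of exponent
when `P'` grows by `P` and `S` by `R`. -/
theorem sum_burgeCoeff_mul_bosSum (hP' : 0 < P') (hP : 0 < P) (hS : 0 ≤ S) (hS' : S ≤ P')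
    (hR : 0 ≤ R) (hR' : R ≤ P) (h : L ≠ ⊤ ∨ M ≠ ⊤) :
    ∑ i ∈ burgeRange L M, q ^ i ^ 2 * (burgeCoeff L M i * bosSum P' P S R (L - i) i) =
      bosSum (P' + P) P (S + R) R L M := by
  have h1 : ∀ i : ℕ, q ^ i ^ 2 * (burgeCoeff L M i * bosSum P' P S R (L - i) i) =
      ∑ᶠ k, q ^ i ^ 2 * (burgeCoeff L M i * bosTerm P' P S R (L - i) i k) := by
    intro i
    rw [bosSum, mul_finsum, mul_finsum]
  rw [Finset.sum_congr rfl fun i _ => h1 i, ← finsum_sum_comm]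
  · refine finsum_congr fun k => ?_
    have e1 := sum_burgeCoeff_mul_gaussPair h (a := k * P') (b := k * P)
      (by simpa using linear_mul_linear_nonneg hP' hP le_rfl hP'.le le_rfl hP.le k)
    have e2 := sum_burgeCoeff_mul_gaussPair h (linear_mul_linear_nonneg hP' hP hS hS' hR hR' k)
    have pull : ∀ (e : RatFunc ℚ) (a b : ℤ),
        ∑ i ∈ burgeRange L M, q ^ i ^ 2 * (burgeCoeff L M i * (e * gaussPair (L - i) i a b)) =
        e * ∑ i ∈ burgeRange L M, q ^ i ^ 2 * (burgeCoeff L M i * gaussPair (L - i) i a b) := by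
      intro e a b
      rw [Finset.mul_sum]
      exact Finset.sum_congr rfl fun i _ => by ring
    simp_rw [bosTerm, mul_sub, Finset.sum_sub_distrib, pull, e1, e2, ← mul_assoc,
      ← zpow_add₀ q_ne_zero]
    congr 2
    · congr 1; ring
    · congr 1; ring
    · congr 1; ring
    · congr 1; ring
  · intro i _
    have hf : (Function.support (bosTerm P' P S R (L - i) i)).Finite :=
      support_bosTerm_finite hP' hP (Or.inr (by simp))
    refine hf.subset fun k hk => ?_
    contrapose! hk
    simp [Function.notMem_support.1 hk]

/-! ### Terminal values and the replacement of `(0, 1)` by `(1, 1)` -/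

/-- Only `k = 0` survives at `L = 0`. For finite `M` the subtracted term there is `[M-1; 0] [M+1;
0]`, which cancels the leading `1` unless `M = 0`. -/
theorem bosSum_zero_one_zero (hP' : 0 < P') (M : ℕ∞) :
    bosSum P' P 0 1 0 M = if M = 0 then 1 else 0 := by
  rw [bosSum, finsum_eq_single _ 0]
  · have h0 : ((0 : ℕ) : ℕ∞) = 0 := rfl
    rw [bosTerm, ← h0]
    induction M using ENat.recTopCoe with
    | top => rw [gaussPair_top_right, gaussPair_top_right]; simp
    | coe M =>
      rw [gaussPair_natCast, gaussPair_natCast]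
      cases M with
      | zero =>
        have := gauss_self 0
        have h1 := gauss_eq_zero (P := -1) (N := 0) (by omega)
        simp_all
      | succ M =>
        have h1 := gauss_zero_right (M + 1)
        have h2 := gauss_zero_right (M + 2)
        have h3 := gauss_zero_right M
        push_cast at h1 h2
        have h4 : ¬((M : ℕ∞) + 1 = 0) := by simp
        simp [h1, h3, show (M : ℤ) + 1 + 1 = M + 2 by ring, h2, h4]
  · intro k hk
    have : ((0 : ℕ) : ℤ) < |k * P'| := by
      rw [Nat.cast_zero]
      exact abs_pos.2 (mul_ne_zero hk hP'.ne')
    have h0 : ((0 : ℕ) : ℕ∞) = 0 := rfl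
    rw [bosTerm, ← h0, gaussPair_eq_zero_left this, gaussPair_eq_zero_left (by simpa using this)]
    simp

/-- The subtracted terms are the leading ones shifted by `k ↦ k + 1`. -/
theorem bosSum_one (h : L ≠ ⊤ ∨ M ≠ ⊤) : bosSum 1 1 1 1 L M = 0 := by
  rw [bosSum_eq_sub one_pos one_pos h, sub_eq_zero, ← finsum_comp_equiv (Equiv.addRight (1 : ℤ))]
  refine finsum_congr fun k => ?_
  simp only [Equiv.coe_addRight, mul_one]
  congr 2; ring

theorem bosTerm_zero_one_top (M : ℕ) (k : ℤ) :
    bosTerm P' P 0 1 ⊤ M k = q ^ M * bosTerm P' P 1 1 ⊤ M k := by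
  simp only [bosTerm, gaussPair_top_left]
  generalize ha : k * P' = a
  generalize hb : k * P = b
  have e1 : q ^ (k ^ 2 * P * P' + k * (P' * 1 - P * 0)) = q ^ (a * b + a) := by
    rw [← ha, ← hb]; congr 1; ring
  have e2 : q ^ ((b + 1) * (a + 0)) = q ^ (a * b + a) := by congr 1; ring
  have e3 : q ^ (k ^ 2 * P * P' + k * (P' * 1 - P * 1)) = q ^ (a * b + a) * q ^ (-b) := by
    rw [← ha, ← hb, ← zpow_add₀ q_ne_zero]; congr 1; ring
  have e4 : q ^ ((b + 1) * (a + 1)) = q ^ (a * b + a) * q ^ (b + 1) := by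
    rw [← zpow_add₀ q_ne_zero]; congr 1; ring
  rw [e1, e2, e3, e4, invPoch_eq_mul ((M : ℤ) - (b + 1)), invPoch_eq_mul ((M : ℤ) + b),
    show (M : ℤ) - (b + 1) + 1 = M + -b by ring, show (M : ℤ) + b + 1 = M + (b + 1) by ring,
    zpow_add₀ q_ne_zero (M : ℤ), zpow_add₀ q_ne_zero (M : ℤ), zpow_natCast,
    show (M : ℤ) + -b = M - b by ring]
  ring

/-- The telescoping part of the difference between the two sides of `bosSum_zero_one`. -/
noncomputable def flipTerm (P' P : ℤ) (L M : ℕ) (k : ℤ) : RatFunc ℚ :=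
  q ^ (M + L + k * P' * (k * P) - k * P) * (gauss (L + M + k * P' - k * P - 1) (L + k * P' - 1) *
    gauss (L + M - k * P' + k * P - 1) (L - k * P'))

theorem support_flipTerm_finite (hP' : 0 < P') (L M : ℕ) :
    (Function.support (flipTerm P' P L M)).Finite := by
  refine (finite_setOf_abs_le hP' 0 L).subset fun k hk => ?_
  by_contra hlt
  apply hk
  have hlt' : (L : ℤ) < |k * P'| := by simpa using hlt
  unfold flipTerm
  rcases lt_abs.1 hlt' with h | h
  · rw [gauss_eq_zero (N := (L : ℤ) - k * P') (by omega)]; simp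
  · rw [gauss_eq_zero (N := (L : ℤ) + k * P' - 1) (by omega)]; simp

/-- At finite `L`, unlike at `L = ∞`, the relation fails termwise. Pascal's rule shows the defect to
be odd in `k`, so that it cancels in the sum. -/
theorem bosTerm_zero_one_natCast (hP' : 0 < P') (hP : 0 < P) (L M : ℕ) (k : ℤ) :
    bosTerm P' P 0 1 (L + 1 : ℕ) M k = q ^ M * bosTerm P' P 1 1 L M k +
      (flipTerm P' P (L + 1) M k - flipTerm P' P (L + 1) M (-k)) := by
  simp only [bosTerm, gaussPair_natCast, flipTerm, neg_mul]
  -- That `kP'` and `kP` have the same sign keeps the uses of Pascal's rule below away from its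
  -- exceptional case.
  have hsign : (k * P' = 0 ∧ k * P = 0) ∨ (0 < k * P' ∧ 0 < k * P) ∨ (k * P' < 0 ∧ k * P < 0) := by
    rcases lt_trichotomy k 0 with hk | rfl | hk
    · exact Or.inr (Or.inr ⟨mul_neg_of_neg_of_pos hk hP', mul_neg_of_neg_of_pos hk hP⟩)
    · simp
    · exact Or.inr (Or.inl ⟨mul_pos hk hP', mul_pos hk hP⟩)
  have e1 : q ^ (k ^ 2 * P * P' + k * (P' * 1 - P * 0)) = q ^ (k * P' * (k * P) + k * P') := by
    congr 1; ring
  have e3 : q ^ (k ^ 2 * P * P' + k * (P' * 1 - P * 1)) =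
      q ^ (k * P' * (k * P) + k * P') * q ^ (-(k * P)) := by
    rw [← zpow_add₀ q_ne_zero]; congr 1; ring
  rw [e1, e3]
  generalize k * P' = a at hsign ⊢
  generalize k * P = b at hsign ⊢
  have e2 : q ^ ((b + 1) * (a + 0)) = q ^ (a * b + a) := by congr 1; ring
  have e4 : q ^ ((b + 1) * (a + 1)) = q ^ (a * b + a) * q ^ (b + 1) := by
    rw [← zpow_add₀ q_ne_zero]; congr 1; ring
  have e5 : q ^ ((M : ℤ) + (L + 1 : ℕ) + a * b - b) =
      q ^ (a * b + a) * (q ^ (M + -b) * q ^ (L + 1 - a)) := by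
    rw [← zpow_add₀ q_ne_zero, ← zpow_add₀ q_ne_zero]; congr 1; push_cast; ring
  have e6 : q ^ ((M : ℤ) + (L + 1 : ℕ) + -(a * -b) - -b) =
      q ^ (a * b + a) * (q ^ (M + (b + 1)) * q ^ (L - a)) := by
    rw [← zpow_add₀ q_ne_zero, ← zpow_add₀ q_ne_zero]; congr 1; push_cast; ring
  rw [e2, e4, e5, e6]
  push_cast
  have p1 := gauss_pascal' (P := (L : ℤ) + M + a - b) (N := (L : ℤ) + a) (by omega)
  have p2 := gauss_pascal (P := (L : ℤ) + 1 + M - a + b) (N := (L : ℤ) - a) (by omega)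
  have p2' := gauss_pascal' (P := (L : ℤ) + 1 + M - a + b) (N := (L : ℤ) - a) (by omega)
  have p3 := gauss_pascal (P := (L : ℤ) + M - a + b) (N := (L : ℤ) - a) (by omega)
  have p4 := gauss_pascal (P := (L : ℤ) + M - a + b) (N := (L : ℤ) - a - 1) (by omega)
  rw [show (L : ℤ) + M + a - b - (L + a) = M + -b by ring] at p1
  rw [show (L : ℤ) + 1 + M - a + b - (L - a) = M + (b + 1) by ring] at p2'
  rw [show (L : ℤ) - a - 1 + 1 = L - a by ring] at p4
  rw [show (L : ℤ) + 1 + M + a - b = L + M + a - b + 1 by ring,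
    show (L : ℤ) + 1 + a = L + a + 1 by ring, p1,
    show (L : ℤ) + 1 + M - (a + 0) + (b + 1) = L + 1 + M - a + b + 1 by ring,
    show (L : ℤ) + 1 - (a + 0) = L - a + 1 by ring, p2',
    show (L : ℤ) + 1 - a = L - a + 1 by ring,
    show (L : ℤ) + 1 + M - a + b = L + M - a + b + 1 by ring, p3, p4,
    show (L : ℤ) + 1 + M + (a + 0) - (b + 1) = L + M + a - b by ring,
    show (L : ℤ) + 1 + (a + 0) = L + a + 1 by ring,
    show (L : ℤ) + M + (a + 1) - (b + 1) = L + M + a - b by ring,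
    show (L : ℤ) + M - (a + 1) + (b + 1) = L + M - a + b by ring,
    show (L : ℤ) + (a + 1) = L + a + 1 by ring,
    show (L : ℤ) - (a + 1) = L - a - 1 by ring,
    show (L : ℤ) + M + a - b + 1 - 1 = L + M + a - b by ring,
    show (L : ℤ) + a + 1 - 1 = L + a by ring,
    show (L : ℤ) + M - a + b + 1 - 1 = L + M - a + b by ring,
    show (L : ℤ) + 1 + M + -a - -b - 1 = L + M - a + b by ring,
    show (L : ℤ) + 1 + -a - 1 = L - a by ring,
    show (L : ℤ) + 1 + M - -a + -b - 1 = L + M + a - b by ring,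
    show (L : ℤ) + 1 - -a = L + a + 1 by ring,
    zpow_add₀ q_ne_zero (M : ℤ), zpow_add₀ q_ne_zero (M : ℤ), zpow_natCast]
  ring

theorem bosSum_zero_one (hP' : 0 < P') (hP : 0 < P) (hL : L ≠ 0) (M : ℕ) :
    bosSum P' P 0 1 L M = q ^ M * bosSum P' P 1 1 (L - 1) M := by
  rw [bosSum, bosSum, mul_finsum]
  induction L using ENat.recTopCoe with
  | top =>
    rw [show (⊤ : ℕ∞) - 1 = ⊤ from ENat.top_sub_natCast 1]
    exact finsum_congr fun k => bosTerm_zero_one_top M k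
  | coe L =>
    obtain ⟨L, rfl⟩ := Nat.exists_eq_succ_of_ne_zero (by simpa using hL : L ≠ 0)
    have e : ((L.succ : ℕ) : ℕ∞) - 1 = (L : ℕ) := by
      rw [← Nat.cast_one, ← ENat.natCast_sub]; simp
    have hf : (Function.support (flipTerm P' P (L + 1) M)).Finite :=
      support_flipTerm_finite hP' _ _
    have hf' : (Function.support fun k => flipTerm P' P (L + 1) M (-k)).Finite :=
      hf.preimage (Equiv.neg ℤ).injective.injOn
    have hneg : ∑ᶠ k, flipTerm P' P (L + 1) M (-k) = ∑ᶠ k, flipTerm P' P (L + 1) M k :=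
      finsum_comp_equiv (Equiv.neg ℤ)
    rw [e, finsum_congr fun k => bosTerm_zero_one_natCast hP' hP L M k, finsum_add_distrib,
      finsum_sub_distrib hf hf', hneg,
      sub_self, add_zero]
    · refine (support_bosTerm_finite hP' hP (Or.inl (by simp)) : (Function.support
        (bosTerm P' P 1 1 L M)).Finite).subset fun k hk => ?_
      contrapose! hk
      simp [Function.notMem_support.1 hk]
    · exact (hf.union hf').subset (Function.support_sub _ _)

/-- The value of the part of the fermionic sum beyond the branching level, as a function of the
bounds of the current partition. -/
noncomputable def tailSum (P' P : ℤ) (L M : ℕ∞) : RatFunc ℚ :=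
  if M = 0 then (if L = 0 then 1 else 0) else bosSum P' P 1 1 L (M - 1)

theorem burgeCoeff_zero_left (M : ℕ∞) : burgeCoeff 0 M 0 = 1 := by
  induction M using ENat.recTopCoe with
  | top => simpa using burgeCoeff_top_right 0 0
  | coe M => simpa using burgeCoeff_natCast 0 M 0

theorem burgeCoeff_zero_right (L : ℕ∞) : burgeCoeff L 0 0 = 1 := by
  induction L using ENat.recTopCoe with
  | top => simpa using burgeCoeff_top_left 0 0
  | coe L => simpa using (burgeCoeff_natCast L 0 0).trans (by simpa using gauss_zero_right (2 * L))

theorem burgeCoeff_add_one (h : L ≠ ⊤ ∨ M ≠ ⊤) (i : ℕ) :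
    burgeCoeff L (M + 1) (i + 1) = burgeCoeff L M i := by
  induction M using ENat.recTopCoe with
  | top =>
    have hL : L ≠ ⊤ := by simpa using h
    lift L to ℕ using hL
    simp [burgeCoeff]
  | coe M =>
    rw [← Nat.cast_one, ← Nat.cast_add]
    induction L using ENat.recTopCoe with
    | top => rw [burgeCoeff_top_left, burgeCoeff_top_left]; congr 1; push_cast; ring
    | coe L => rw [burgeCoeff_natCast, burgeCoeff_natCast]; congr 1 <;> push_cast <;> ring

theorem add_one_sub_one (M : ℕ∞) : M + 1 - 1 = M := by
  induction M using ENat.recTopCoe with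
  | top => rfl
  | coe M => norm_cast

theorem burgeRange_zero_left (M : ℕ∞) : burgeRange 0 M = {0} := by simp [burgeRange]

theorem burgeRange_zero_right (L : ℕ∞) : burgeRange L 0 = {0} := by simp [burgeRange]

/-- Write `M = m + 1`. The right side is a sum for `(P'+P, P, 0+1, 1)` with bounds `(L, m)`; the
Burge transform leads to `(P', P, 0, 1)` and `bosSum_zero_one` on to `(P', P, 1, 1)` with a factor
`q^j`. Since `j² + j = (j+1)j`, the index `i = j + 1` gives the left side. -/
theorem sum_burgeCoeff_mul_tailSum (hP' : 0 < P') (hP : 0 < P) (h : L ≠ ⊤ ∨ M ≠ ⊤) :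
    ∑ i ∈ burgeRange L M, q ^ (i * (i - 1)) * (burgeCoeff L M i * tailSum P' P (L - i) i) =
      tailSum (P' + P) P L M := by
  rcases eq_or_ne M 0 with rfl | hM
  · simp [burgeRange_zero_right, burgeCoeff_zero_right, tailSum]
  obtain ⟨m, rfl⟩ : ∃ m, M = m + 1 := ⟨M - 1, (tsub_add_cancel_of_le (Order.one_le_iff_ne_zero.2 hM)).symm⟩
  have hm : L ≠ ⊤ ∨ m ≠ ⊤ := h.imp id (by rintro h rfl; simp at h)
  have hRHS : tailSum (P' + P) P L (m + 1) = bosSum (P' + P) P (0 + 1) 1 L m := by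
    simp [tailSum, add_one_sub_one]
  rw [hRHS, ← sum_burgeCoeff_mul_bosSum hP' hP le_rfl hP'.le zero_le_one hP hm]
  rcases eq_or_ne L 0 with rfl | hL
  · simp [burgeRange_zero_left, burgeCoeff_zero_left, tailSum, bosSum_zero_one_zero hP']
  have hr : burgeRange L (m + 1) =
      insert 0 (((burgeRange L m).filter fun j : ℕ => (j : ℕ∞) + 1 ≤ L).image Nat.succ) := by
    ext i
    rw [mem_burgeRange h, Finset.mem_insert, Finset.mem_image]
    cases i with
    | zero => simp
    | succ i => 
      simp only [Finset.mem_filter, mem_burgeRange hm, Nat.succ_eq_add_one, Nat.cast_add,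
        Nat.cast_one, add_left_inj, exists_eq_right, Nat.add_eq_zero_iff, one_ne_zero, and_false,
        false_or]
      rw [ENat.add_le_add_iff_right ENat.one_ne_top]
      exact ⟨fun h => ⟨⟨le_self_add.trans h.1, h.2⟩, h.1⟩, fun h => ⟨h.2, h.1.2⟩⟩
  rw [hr, Finset.sum_insert (by simp), Finset.sum_image (by simp),
    ← Finset.sum_filter_add_sum_filter_not (burgeRange L m) fun j : ℕ => (j : ℕ∞) + 1 ≤ L]
  have z1 : tailSum P' P (L - (0 : ℕ)) (0 : ℕ) = 0 := by simp [tailSum, hL]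
  rw [z1, mul_zero, mul_zero, zero_add, Finset.sum_congr rfl fun j hj => ?_]
  · rw [left_eq_add]
    -- Only `j = L` has no counterpart `j + 1 ≤ L`; its term vanishes because `L ≠ 0`.
    refine Finset.sum_eq_zero fun j hj => ?_
    rw [Finset.mem_filter, mem_burgeRange hm] at hj
    have hjL : L = j := le_antisymm (by
      rw [not_le] at hj
      exact Order.le_of_lt_add_one hj.2) hj.1.1
    have hj0 : (j : ℕ∞) ≠ 0 := hjL ▸ hL
    rw [hjL, tsub_self, bosSum_zero_one_zero hP', if_neg hj0]
    simp
  · rw [Finset.mem_filter] at hj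
    have h1 : L - j ≠ 0 := by
      intro h0
      have := hj.2.trans (tsub_eq_zero_iff_le.1 h0)
      exact absurd this (by rw [← Nat.cast_one, ← Nat.cast_add, ENat.natCast_le_natCast]; omega)
    rw [bosSum_zero_one hP' hP h1, Nat.succ_eq_add_one, burgeCoeff_add_one hm, tailSum,
      if_neg (by simp), Nat.cast_add, Nat.cast_one, add_one_sub_one,
      tsub_tsub, Nat.add_sub_cancel]
    rw [show (j + 1) * j = j ^ 2 + j by ring, pow_add]
    ring

/-- Undoing the shift in `M`, exchanging the bounds and shifting again gives `(M - 1, L + 1)`, the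
rule for passing from one tail level to the next. -/
theorem tailSum_swap (hP' : 0 < P') (hP : 0 < P) (h : L ≠ ⊤ ∨ M ≠ ⊤) (hM : M ≠ 0) :
    tailSum P P' (M - 1) (L + 1) = tailSum P' P L M := by
  have h' : L ≠ ⊤ ∨ M - 1 ≠ ⊤ := h.imp id fun h => by
    lift M to ℕ using h
    rw [← Nat.cast_one, ← ENat.natCast_sub]; simp
  rw [tailSum, tailSum, if_neg (by simp), if_neg hM, add_one_sub_one,
    bosSum_swap hP' hP h']

/-- One Burge step back leads to `(1 : 1)`, where `bosSum_one` kills every term with `i > 0`. -/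
theorem tailSum_two_one (h : L ≠ ⊤ ∨ M ≠ ⊤) : tailSum 2 1 L M = if L = 0 then 1 else 0 := by
  rw [show (2 : ℤ) = 1 + 1 by norm_num, ← sum_burgeCoeff_mul_tailSum one_pos one_pos h,
    Finset.sum_eq_single 0]
  · rcases eq_or_ne L 0 with rfl | hL
    · simp [tailSum, burgeCoeff_zero_left]
    · simp [tailSum, hL]
  · intro i _ hi
    rw [tailSum, if_neg (by simpa using hi), bosSum_one (Or.inr _)]
    · simp
    · rw [← Nat.cast_one, ← ENat.natCast_sub]; simp
  · intro h0
    exact absurd ((mem_burgeRange h).2 (by simp)) h0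

end

/-! ### Sums over single partitions -/

/-- The parts of a partition, preceded by its bound `top`. -/
def boundedEntry (top : ℕ∞) (P : List ℕ) (i : ℕ) : ℕ∞ :=
  if i = 0 then top else (P.getD (i - 1) 0 : ℕ)

@[simp] theorem boundedEntry_zero (top : ℕ∞) (P : List ℕ) : boundedEntry top P 0 = top := rfl

theorem boundedEntry_cons (top : ℕ∞) (a : ℕ) (P : List ℕ) (i : ℕ) :
    boundedEntry top (a :: P) (i + 1) = boundedEntry a P i := by
  cases i <;> simp [boundedEntry]

/-- The last part of a partition, or its bound if there are no parts. -/
def lastEntry (top : ℕ∞) (P : List ℕ) : ℕ∞ := boundedEntry top P P.length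

@[simp] theorem lastEntry_nil (top : ℕ∞) : lastEntry top [] = top := rfl

@[simp] theorem lastEntry_cons (top : ℕ∞) (a : ℕ) (P : List ℕ) :
    lastEntry top (a :: P) = lastEntry a P := boundedEntry_cons top a P P.length

theorem lastEntry_ne_top {top : ℕ∞} {P : List ℕ} (h : top ≠ ⊤ ∨ P ≠ []) :
    lastEntry top P ≠ ⊤ := by
  unfold lastEntry boundedEntry
  split_ifs with h0
  · rcases h with h | h
    · exact h
    · exact absurd (List.length_eq_zero_iff.1 h0) h
  · simp

/-- The partitions with `f` parts (possibly zero), each at most `top`, of weight at most `w`. -/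
noncomputable def boundedParts : ℕ → ℕ∞ → ℕ∞ → Finset (List ℕ)
  | 0, _, _ => {[]}
  | f + 1, w, top =>
    (burgeRange w top).biUnion fun i => (boundedParts f (w - i) i).image (List.cons i)

theorem mem_boundedParts {f : ℕ} {w top : ℕ∞} (h : w ≠ ⊤ ∨ top ≠ ⊤) {P : List ℕ} :
    P ∈ boundedParts f w top ↔ P.length = f ∧
      (∀ i, 1 ≤ i → i ≤ f → boundedEntry top P i ≤ boundedEntry top P (i - 1)) ∧
      (P.sum : ℕ∞) ≤ w := by
  induction f generalizing w top P with
  | zero =>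
    rw [boundedParts, Finset.mem_singleton]
    constructor
    · rintro rfl
      exact ⟨rfl, fun i h1 h2 => by omega, by simp⟩
    · exact fun h => List.length_eq_zero_iff.1 h.1
  | succ f ih =>
    simp only [boundedParts, Finset.mem_biUnion, Finset.mem_image]
    constructor
    · rintro ⟨a, ha, P, hP, rfl⟩
      rw [mem_burgeRange h] at ha
      rw [ih (Or.inr (by simp))] at hP
      refine ⟨by simp [hP.1], fun i h1 h2 => ?_, ?_⟩
      · obtain ⟨i, rfl⟩ := Nat.exists_eq_add_of_le' h1
        rw [boundedEntry_cons, Nat.add_sub_cancel]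
        cases i with
        | zero => simpa using ha.2
        | succ i =>
          rw [boundedEntry_cons]
          exact hP.2.1 (i + 1) (by omega) (by omega)
      · rw [List.sum_cons, Nat.cast_add]
        exact (add_le_add_right hP.2.2 _).trans (add_tsub_cancel_of_le ha.1).le
    · rintro ⟨hl, hm, hs⟩
      cases P with
      | nil => simp at hl
      | cons a P =>
        rw [List.sum_cons, Nat.cast_add] at hs
        refine ⟨a, (mem_burgeRange h).2 ⟨le_self_add.trans hs, ?_⟩, P, ?_, rfl⟩
        · simpa [boundedEntry] using hm 1 le_rfl (by omega)
        · rw [ih (Or.inr (by simp))]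
          refine ⟨by simpa using hl, fun i h1 h2 => ?_, ?_⟩
          · have := hm (i + 1) (by omega) (by omega)
            obtain ⟨i, rfl⟩ := Nat.exists_eq_add_of_le' h1
            rwa [boundedEntry_cons, Nat.add_sub_cancel, boundedEntry_cons] at this
          · exact ENat.le_sub_of_add_le_left (by simp) hs

theorem sum_boundedParts_succ (f : ℕ) (w top : ℕ∞) (g : List ℕ → RatFunc ℚ) :
    ∑ P ∈ boundedParts (f + 1) w top, g P =
      ∑ i ∈ burgeRange w top, ∑ P ∈ boundedParts f (w - i) i, g (i :: P) := by
  rw [boundedParts, Finset.sum_biUnion]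
  · refine Finset.sum_congr rfl fun i _ => Finset.sum_image ?_
    intro a _ b _ hab
    exact (List.cons.inj hab).2
  · intro i _ j _ hij
    rw [Function.onFun, Finset.disjoint_left]
    intro P hP hP'
    obtain ⟨a, _, rfl⟩ := Finset.mem_image.1 hP
    obtain ⟨b, _, hb⟩ := Finset.mem_image.1 hP'
    exact hij (List.cons.inj hb).1.symm

/-- The contribution of a single partition to a summand of the fermionic sum. -/
noncomputable def partTerm (e : ℕ → ℕ) : ℕ∞ → ℕ∞ → List ℕ → RatFunc ℚ
  | _, _, [] => 1
  | w, top, i :: P => q ^ e i * (burgeCoeff w top i * partTerm e (w - i) i P)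

/-- Unfolds a one-part recursion over a whole partition. It is stated for an arbitrary `Φ` so as to
serve both `bosSum` and `tailSum`. -/
theorem sum_partTerm_mul (e : ℕ → ℕ) (Φ : ℕ → ℕ∞ → ℕ∞ → RatFunc ℚ)
    (hΦ : ∀ f w top, w ≠ ⊤ ∨ top ≠ ⊤ → Φ (f + 1) w top =
      ∑ i ∈ burgeRange w top, q ^ e i * (burgeCoeff w top i * Φ f (w - i) i))
    (f : ℕ) {w top : ℕ∞} (h : w ≠ ⊤ ∨ top ≠ ⊤) :
    ∑ P ∈ boundedParts f w top,
      partTerm e w top P * Φ 0 (w - (P.sum : ℕ)) (lastEntry top P) = Φ f w top := by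
  induction f generalizing w top with
  | zero => simp [boundedParts, partTerm]
  | succ f ih =>
    rw [sum_boundedParts_succ, hΦ f w top h]
    refine Finset.sum_congr rfl fun i _ => ?_
    rw [← ih (Or.inr (by simp)), Finset.mul_sum, Finset.mul_sum]
    refine Finset.sum_congr rfl fun P _ => ?_
    rw [partTerm, List.sum_cons, Nat.cast_add, lastEntry_cons, tsub_add_eq_tsub_tsub]
    ring

theorem partTerm_eq_prod (e : ℕ → ℕ) (w top : ℕ∞) (P : List ℕ) :
    partTerm e w top P = ∏ i ∈ Finset.range P.length, q ^ e (P.getD i 0) *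
      burgeCoeff (w - (∑ j ∈ Finset.range i, P.getD j 0 : ℕ)) (boundedEntry top P i)
        (P.getD i 0) := by
  induction P generalizing w top with
  | nil => simp [partTerm]
  | cons a P ih =>
    rw [partTerm, ih, List.length_cons, Finset.prod_range_succ']
    simp only [List.getD_cons_zero, List.getD_cons_succ, Finset.sum_range_zero, Nat.cast_zero,
      tsub_zero, boundedEntry_zero, boundedEntry_cons, Finset.sum_range_succ']
    rw [← mul_assoc, mul_comm]
    congr 1
    refine Finset.prod_congr rfl fun i _ => ?_
    rw [add_comm, Nat.cast_add, tsub_add_eq_tsub_tsub]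

/-! ### Sums over sequences of partitions -/

/-- The bounds of the partition after the `k`-th one, in terms of the bound `w`, the weight `s`
and the last part `m` of the `k`-th one. -/
noncomputable def nextBounds (u k : ℕ) (w : ℕ∞) (s : ℕ) (m : ℕ∞) : ℕ∞ × ℕ∞ :=
  if k + 1 ≤ u then (m, w - s) else if k = u then (w - 1 - s, m + 1) else (m - 1, w + 1 - s)

theorem nextBounds_ne_top {u k : ℕ} {w m : ℕ∞} {s : ℕ} (h : w ≠ ⊤ ∨ m ≠ ⊤) :
    (nextBounds u k w s m).1 ≠ ⊤ ∨ (nextBounds u k w s m).2 ≠ ⊤ := by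
  have hs : ∀ x : ℕ∞, x ≠ ⊤ → ∀ y, x - y ≠ ⊤ := fun x hx y => ne_top_of_le_ne_top hx tsub_le_self
  unfold nextBounds
  split_ifs
  · exact h.symm.imp id fun h => hs _ h _
  · exact h.imp (fun h => hs _ (hs _ h _) _) fun h => by simpa using h
  · exact h.symm.imp (fun h => hs _ h _) fun h => hs _ (by simpa using h) _

/-- The exponent contributed by a part of the `k`-th partition. -/
def partExp (u k i : ℕ) : ℕ := if k ≤ u then i ^ 2 else i * (i - 1)

/-- The sequences of at most `j` partitions, the first of which has index `k` and bounds `w` and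
`top`. -/
noncomputable def boundedSeqs (f : ℕ → ℕ) (u t : ℕ) :
    ℕ → ℕ → ℕ∞ → ℕ∞ → Finset (List (List ℕ))
  | 0, _, _, _ => ∅
  | j + 1, k, w, top => (boundedParts (f k) w top).biUnion fun P =>
    ((if u ≤ k ∧ (P.sum : ℕ∞) = w ∧ (k < t + 1 → lastEntry top P = 0) then {[]} else ∅) ∪
      (if (k = u → (P.sum : ℕ∞) < w) ∧ (u < k → 0 < lastEntry top P) then
        boundedSeqs f u t j (k + 1) (nextBounds u k w P.sum (lastEntry top P)).1
          (nextBounds u k w P.sum (lastEntry top P)).2 else ∅)).image (List.cons P)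

/-- The summand of the fermionic sum attached to a sequence of partitions, the first of which has
index `k` and bounds `w` and `top`. -/
noncomputable def seqTerm (u : ℕ) : ℕ → ℕ∞ → ℕ∞ → List (List ℕ) → RatFunc ℚ
  | _, _, _, [] => 1
  | k, w, top, P :: l =>
    partTerm (partExp u k) w top P * ((if k = u then q ^ (lastEntry top P).toNat else 1) *
      seqTerm u (k + 1) (nextBounds u k w P.sum (lastEntry top P)).1
          (nextBounds u k w P.sum (lastEntry top P)).2 l)

section

variable {f : ℕ → ℕ} {u t : ℕ}

theorem nil_notMem_boundedSeqs (j k : ℕ) (w top : ℕ∞) : [] ∉ boundedSeqs f u t j k w top := by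
  cases j <;> simp [boundedSeqs]

theorem sum_boundedSeqs_succ (j k : ℕ) (w top : ℕ∞) :
    ∑ l ∈ boundedSeqs f u t (j + 1) k w top, seqTerm u k w top l =
      ∑ P ∈ boundedParts (f k) w top, partTerm (partExp u k) w top P *
        ((if k = u then q ^ (lastEntry top P).toNat else 1) *
        ((if u ≤ k ∧ (P.sum : ℕ∞) = w ∧ (k < t + 1 → lastEntry top P = 0) then 1 else 0) +
        (if (k = u → (P.sum : ℕ∞) < w) ∧ (u < k → 0 < lastEntry top P) then
          ∑ l ∈ boundedSeqs f u t j (k + 1) (nextBounds u k w P.sum (lastEntry top P)).1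
            (nextBounds u k w P.sum (lastEntry top P)).2,
            seqTerm u (k + 1) (nextBounds u k w P.sum (lastEntry top P)).1
            (nextBounds u k w P.sum (lastEntry top P)).2 l else 0))) := by
  rw [boundedSeqs, Finset.sum_biUnion]
  · refine Finset.sum_congr rfl fun P _ => ?_
    rw [Finset.sum_image (fun a _ b _ hab => (List.cons.inj hab).2)]
    simp_rw [seqTerm, ← Finset.mul_sum]
    rw [Finset.sum_union]
    · congr 3
      · split_ifs <;> simp [seqTerm]
      · split_ifs <;> simp
    · rw [Finset.disjoint_left]
      intro l hl hl'
      split_ifs at hl hl' with h1 h2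
      · rw [Finset.mem_singleton] at hl
        exact nil_notMem_boundedSeqs _ _ _ _ (hl ▸ hl')
      all_goals simp at hl hl'
  · intro i _ j _ hij
    rw [Function.onFun, Finset.disjoint_left]
    intro P hP hP'
    obtain ⟨a, _, rfl⟩ := Finset.mem_image.1 hP
    obtain ⟨b, _, hb⟩ := Finset.mem_image.1 hP'
    exact hij (List.cons.inj hb).1.symm

/-! ### Evaluation of the sums level by level -/

/-- The continuant recursion. -/
def cfFold (l : List ℕ) (x : ℤ × ℤ) : ℤ × ℤ := l.foldr (fun c y => (c * y.1 + y.2, y.1)) x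

@[simp] theorem cfFold_nil (x : ℤ × ℤ) : cfFold [] x = x := rfl

@[simp] theorem cfFold_cons (a : ℕ) (l : List ℕ) (x : ℤ × ℤ) :
    cfFold (a :: l) x = (a * (cfFold l x).1 + (cfFold l x).2, (cfFold l x).1) := rfl

theorem cfFold_append (l l' : List ℕ) (x : ℤ × ℤ) :
    cfFold (l ++ l') x = cfFold l (cfFold l' x) := by simp [cfFold]

theorem cfFold_pos {l : List ℕ} {x : ℤ × ℤ} (h1 : 0 < x.1) (h2 : 0 < x.2) :
    0 < (cfFold l x).1 ∧ 0 < (cfFold l x).2 := by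
  induction l with
  | nil => exact ⟨h1, h2⟩
  | cons a l ih => exact ⟨by simp only [cfFold_cons]; have := ih.1; have := ih.2; positivity, ih.1⟩

theorem tsub_natCast_eq_zero_iff {w : ℕ∞} {s : ℕ} (h : (s : ℕ∞) ≤ w) : w - s = 0 ↔ (s : ℕ∞) = w := by
  rw [tsub_eq_zero_iff_le]
  exact ⟨fun h' => le_antisymm h h', fun h => h.ge⟩

theorem add_one_tsub {w : ℕ∞} {s : ℕ} (h : (s : ℕ∞) ≤ w) : w + 1 - s = w - s + 1 := by
  induction w using ENat.recTopCoe with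
  | top => simp
  | coe w =>
    rw [ENat.natCast_le_natCast] at h
    norm_cast
    omega

theorem tsub_ne_top_or_lastEntry_ne_top {w top : ℕ∞} (h : w ≠ ⊤ ∨ top ≠ ⊤) (P : List ℕ) :
    w - (P.sum : ℕ) ≠ ⊤ ∨ lastEntry top P ≠ ⊤ :=
  h.imp (fun h => ne_top_of_le_ne_top h tsub_le_self) fun h => lastEntry_ne_top (Or.inl h)

theorem sum_partTerm_mul_tailSum {k : ℕ} (hk : u < k) (n : ℕ) {A B : ℤ} (hA : 0 < A) (hB : 0 < B)
    {w top : ℕ∞} (h : w ≠ ⊤ ∨ top ≠ ⊤) :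
    ∑ P ∈ boundedParts n w top, partTerm (partExp u k) w top P *
      tailSum B A (w - (P.sum : ℕ)) (lastEntry top P) = tailSum (n * A + B) A w top := by
  have := sum_partTerm_mul (partExp u k) (fun n w top => tailSum (n * A + B) A w top) ?_ n h
  · simpa using this
  · intro n w top h
    simp only [partExp, if_neg (not_le.2 hk)]
    rw [sum_burgeCoeff_mul_tailSum (by positivity) hA h]
    congr 1; push_cast; ring

/-- The start `(1, 2)` is the terminal pair `(2 : 1)` with its entries exchanged; it accounts for
the `+ 2` in the last partial quotient. -/
theorem sum_seqTerm_tail {j k : ℕ} (hk : u < k) (hkj : k + j = t + 1) {w top : ℕ∞}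
    (h : w ≠ ⊤ ∨ top ≠ ⊤) :
    ∑ l ∈ boundedSeqs f u t (j + 1) k w top, seqTerm u k w top l =
      tailSum (cfFold ((List.range' k (j + 1)).map f) (1, 2)).1
        (cfFold ((List.range' k (j + 1)).map f) (1, 2)).2 w top := by
  induction j generalizing k w top with
  | zero =>
    rw [sum_boundedSeqs_succ]
    simp only [zero_add, List.range'_one, List.map_cons, List.map_nil, cfFold_cons, cfFold_nil]
    rw [← sum_partTerm_mul_tailSum hk (f k) one_pos two_pos h]
    refine Finset.sum_congr rfl fun P hP => ?_
    rw [mem_boundedParts h] at hP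
    rw [tailSum_two_one (tsub_ne_top_or_lastEntry_ne_top h P)]
    simp only [tsub_natCast_eq_zero_iff hP.2.2]
    simp [boundedSeqs, hk.ne', hk.le,
      show ¬ k < t + 1 by omega]
  | succ j ih =>
    rw [sum_boundedSeqs_succ, List.range'_succ, List.map_cons, cfFold_cons]
    have hpos := cfFold_pos (l := (List.range' (k + 1) (j + 1)).map f) (x := (1, 2)) one_pos two_pos
    rw [← sum_partTerm_mul_tailSum hk (f k) hpos.1 hpos.2 h]
    refine Finset.sum_congr rfl fun P hP => ?_
    have h' := tsub_ne_top_or_lastEntry_ne_top h P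
    rw [ih (by omega) (by omega) (nextBounds_ne_top (h.imp id fun h => lastEntry_ne_top (Or.inl h)))]
    rw [mem_boundedParts h] at hP
    simp only [nextBounds, if_neg (show ¬ k + 1 ≤ u by omega), if_neg hk.ne', one_mul, hk, hk.le,
      true_and, forall_const, show k < t + 1 by omega]
    -- A zero last part forces the sequence to end, with weight `w`; a positive one forces it to go
    -- on. These are the two branches of `tailSum`.
    rcases eq_or_ne (lastEntry top P) 0 with h0 | h0
    · simp only [h0, tailSum, tsub_natCast_eq_zero_iff hP.2.2]
      simp [hk.ne']
    · rw [show w + 1 - (P.sum : ℕ∞) = w - P.sum + 1 from add_one_tsub hP.2.2,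
        tailSum_swap hpos.2 hpos.1 h' h0]
      simp [h0, hk.ne', pos_iff_ne_zero]

theorem sum_partTerm_mul_bosSum {k : ℕ} (hk : k ≤ u) (n : ℕ) {P' P S R : ℤ} (hP' : 0 < P')
    (hP : 0 < P) (hS : 0 ≤ S) (hS' : S ≤ P') (hR : 0 ≤ R) (hR' : R ≤ P)
    {w top : ℕ∞} (h : w ≠ ⊤ ∨ top ≠ ⊤) :
    ∑ Q ∈ boundedParts n w top, partTerm (partExp u k) w top Q *
      bosSum P' P S R (w - (Q.sum : ℕ)) (lastEntry top Q) =
      bosSum (n * P + P') P (n * R + S) R w top := by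
  have := sum_partTerm_mul (partExp u k)
    (fun n w top => bosSum (n * P + P') P (n * R + S) R w top) ?_ n h
  · simpa using this
  · intro n w top h
    simp only [partExp, if_pos hk]
    rw [sum_burgeCoeff_mul_bosSum (by positivity) hP (by positivity) (by gcongr) hR hR' h]
    congr 1 <;> push_cast <;> ring

theorem cfFold_le {l : List ℕ} {x y : ℤ × ℤ} (h1 : 0 ≤ x.1) (h1' : x.1 ≤ y.1) (h2 : 0 ≤ x.2)
    (h2' : x.2 ≤ y.2) : (0 ≤ (cfFold l x).1 ∧ (cfFold l x).1 ≤ (cfFold l y).1) ∧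
      0 ≤ (cfFold l x).2 ∧ (cfFold l x).2 ≤ (cfFold l y).2 := by
  induction l with
  | nil => exact ⟨⟨h1, h1'⟩, h2, h2'⟩
  | cons a l ih =>
    obtain ⟨⟨h3, h4⟩, h5, h6⟩ := ih
    simp only [cfFold_cons]
    exact ⟨⟨by positivity, by gcongr⟩, h3, h4⟩

/-- The pair `(p' : p)` remaining at the branching level. -/
def branchPair (f : ℕ → ℕ) (u t : ℕ) : ℤ × ℤ :=
  (f u * (cfFold ((List.range' (u + 1) (t + 1 - u)).map f) (1, 2)).2 +
    (cfFold ((List.range' (u + 1) (t + 1 - u)).map f) (1, 2)).1,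
    (cfFold ((List.range' (u + 1) (t + 1 - u)).map f) (1, 2)).2)

/-- The bounds are not exchanged between levels `u` and `u + 1`, so the steps of these two levels
add up to one partial quotient. -/
theorem sum_seqTerm_branch (hut : u ≤ t) (hfu : 1 ≤ f u) {w top : ℕ∞} (h : w ≠ ⊤ ∨ top ≠ ⊤) :
    ∑ l ∈ boundedSeqs f u t (t + 1 - u + 1) u w top, seqTerm u u w top l =
      bosSum (branchPair f u t).1 (branchPair f u t).2 (f u) 1 w top := by
  rw [sum_boundedSeqs_succ, branchPair]
  obtain ⟨j, hj⟩ : ∃ j, t + 1 - u = j + 1 := ⟨t - u, by omega⟩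
  rw [hj]
  have hpos := cfFold_pos (l := (List.range' (u + 1) (j + 1)).map f) (x := (1, 2)) one_pos two_pos
  have key := sum_partTerm_mul_bosSum (le_refl u) (f u) hpos.1 hpos.2 le_rfl hpos.1.le zero_le_one
    hpos.2 h
  rw [mul_one, add_zero] at key
  rw [← key]
  refine Finset.sum_congr rfl fun P hP => ?_
  have h' := tsub_ne_top_or_lastEntry_ne_top h P
  rw [sum_seqTerm_tail (by omega) (by omega)
    (nextBounds_ne_top (h.imp id fun h => lastEntry_ne_top (Or.inl h)))]
  rw [mem_boundedParts h] at hP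
  -- Since `f u ≥ 1` there is a last part, so the second bound is finite, as `bosSum_zero_one`
  -- requires.
  obtain ⟨M, hM⟩ := ENat.ne_top_iff_exists.1 (lastEntry_ne_top (top := top) (P := P)
    (Or.inr (by rintro rfl; simp at hP; omega)))
  simp only [nextBounds, if_neg (show ¬ u + 1 ≤ u by omega), if_true, le_refl, true_and,
    forall_const, lt_irrefl, false_imp_iff, and_true, show u < t + 1 by omega, ← hM]
  -- Weight equal to `w` gives the sequences ending at level `u`; smaller weight gives the factor
  -- `q^M` and the bounds `(w - 1 - wt, M + 1)` of the tail.
  rcases eq_or_ne (w - (P.sum : ℕ∞)) 0 with h0 | h0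
  · have h1 := (tsub_natCast_eq_zero_iff hP.2.2).1 h0
    rw [h0, bosSum_zero_one_zero hpos.1, if_neg (show ¬ (P.sum : ℕ∞) < w by simp [h1])]
    rcases eq_or_ne M 0 with rfl | hM0
    · simp only [h1, Nat.cast_zero, and_self, if_true, ENat.toNat_zero, pow_zero]
      ring
    · simp [hM0]
  · have h1 : (P.sum : ℕ∞) < w :=
      lt_of_le_of_ne hP.2.2 fun h => h0 ((tsub_natCast_eq_zero_iff hP.2.2).2 h)
    rw [if_pos h1, bosSum_zero_one hpos.1 hpos.2 h0, if_neg (fun hc => h1.ne hc.1), tailSum,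
      if_neg (by simp), add_one_sub_one, tsub_right_comm]
    simp

/-- Each level before `u` performs `f k` Burge steps after an exchange of the bounds, which is one
continuant step for both pairs. `cfFold_le` supplies the inequalities that the transform needs. -/
theorem sum_seqTerm_head (hut : u ≤ t) (hfu : 1 ≤ f u) {i k : ℕ} (hk : k + i = u) {w top : ℕ∞}
    (h : w ≠ ⊤ ∨ top ≠ ⊤) :
    ∑ l ∈ boundedSeqs f u t (t + 1 - k + 1) k w top, seqTerm u k w top l =
      bosSum (cfFold ((List.range' k i).map f) (branchPair f u t)).1
        (cfFold ((List.range' k i).map f) (branchPair f u t)).2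
        (cfFold ((List.range' k i).map f) (f u, 1)).1
        (cfFold ((List.range' k i).map f) (f u, 1)).2 w top := by
  induction i generalizing k w top with
  | zero =>
    obtain rfl : k = u := by omega
    exact sum_seqTerm_branch hut hfu h
  | succ i ih =>
    rw [sum_boundedSeqs_succ, List.range'_succ, List.map_cons, cfFold_cons, cfFold_cons]
    have hpos := cfFold_pos (l := (List.range' (u + 1) (t + 1 - u)).map f) (x := (1, 2))
      one_pos two_pos
    have h1 : (0 : ℤ) < (branchPair f u t).1 := by
      have := hpos.1; have := hpos.2; simp only [branchPair]; positivity
    have h2 : (0 : ℤ) < (branchPair f u t).2 := hpos.2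
    have h3 : ((f u : ℤ), (1 : ℤ)).1 ≤ (branchPair f u t).1 := by
      simp only [branchPair]; nlinarith [hpos.1, hpos.2, (f u : ℤ).le_refl, Nat.cast_nonneg (α := ℤ) (f u)]
    have hpos' := cfFold_pos (l := (List.range' (k + 1) i).map f) h1 h2
    have hle := cfFold_le (l := (List.range' (k + 1) i).map f) (x := ((f u : ℤ), (1 : ℤ)))
      (y := branchPair f u t) (by positivity) h3 zero_le_one h2
    rw [← sum_partTerm_mul_bosSum (u := u) (k := k) (by omega) (f k) hpos'.2 hpos'.1 hle.2.1 hle.2.2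
      hle.1.1 hle.1.2 h]
    refine Finset.sum_congr rfl fun P hP => ?_
    have h' := tsub_ne_top_or_lastEntry_ne_top h P
    rw [show t + 1 - k = t + 1 - (k + 1) + 1 by omega, ih (by omega)
      (nextBounds_ne_top (h.imp id fun h => lastEntry_ne_top (Or.inl h)))]
    simp only [nextBounds, if_pos (show k + 1 ≤ u by omega), show ¬ u ≤ k by omega,
      show ¬ k = u by omega, show ¬ u < k by omega, if_false, false_and, zero_add, one_mul,
      false_imp_iff, and_self, if_true]
    rw [bosSum_swap hpos'.2 hpos'.1 h']

end

/-! ### Admissible sequences -/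

section

variable {f : ℕ → ℕ} {u t N : ℕ} {n : List (List ℕ)}

theorem entry_eq_boundedEntry (k i : ℕ) :
    entry f u N n k i = boundedEntry (bounds f u N n k).2 (part n k) i := rfl

theorem entry_eq_lastEntry {k : ℕ} (h : (part n k).length = f k) :
    entry f u N n k (f k) = lastEntry (bounds f u N n k).2 (part n k) := by
  rw [lastEntry, h, entry_eq_boundedEntry]

theorem bounds_succ {k : ℕ} (hk : 1 ≤ k) (h : (part n k).length = f k) :
    bounds f u N n (k + 1) = nextBounds u k (bounds f u N n k).1 (part n k).sum
      (lastEntry (bounds f u N n k).2 (part n k)) := by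
  obtain ⟨k, rfl⟩ := Nat.exists_eq_add_of_le' hk
  simp only [bounds, nextBounds, lastEntry, boundedEntry, h, wt]
  split_ifs <;> first | rfl | omega

/-- The conditions on the `k`-th partition of an admissible sequence. -/
structure AdmissibleAt (f : ℕ → ℕ) (t u N : ℕ) (n : List (List ℕ)) (k : ℕ) : Prop where
  length_part : (part n k).length = f k
  antitone : ∀ i, 1 ≤ i → i ≤ f k → entry f u N n k i ≤ entry f u N n k (i - 1)
  wt_le : (wt n k : ℕ∞) ≤ wBound f u N n k
  wt_eq : k = n.length → (wt n k : ℕ∞) = wBound f u N n k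
  wt_lt : k = u → u < n.length → (wt n k : ℕ∞) < wBound f u N n k
  last_pos : u < k → k < n.length → 0 < entry f u N n k (f k)
  last_eq_zero : k = n.length → k < t + 1 → entry f u N n k (f k) = 0

theorem admissible_iff {c : ℕ → ℕ} {d : ℕ} (hu : 1 ≤ u) : Admissible c t u d N n ↔
    u ≤ n.length ∧ n.length ≤ t + 1 ∧
      ∀ k, 1 ≤ k → k ≤ n.length → AdmissibleAt (fSeq c u d) t u N n k := by
  constructor
  · rintro ⟨h1, h2, h3, h4, h5, h6, h7, h8, h9⟩
    exact ⟨h1, h2, fun k hk hk' => ⟨h3 k hk hk', h4 k hk hk', h5 k hk hk', by rintro rfl; exact h6,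
      by rintro rfl; exact h7, h8 k, by rintro rfl; exact h9⟩⟩
  · rintro ⟨h1, h2, h⟩
    exact ⟨h1, h2, fun k hk hk' => (h k hk hk').length_part,
      fun k hk hk' => (h k hk hk').antitone, fun k hk hk' => (h k hk hk').wt_le,
      (h _ (by omega) le_rfl).wt_eq rfl, (h u hu h1).wt_lt rfl,
      fun k hk hk' => (h k (by omega) hk'.le).last_pos hk hk',
      (h _ (by omega) le_rfl).last_eq_zero rfl⟩

theorem drop_sub_one_eq_cons {k : ℕ} (hk : 1 ≤ k) (hkn : k ≤ n.length) :
    n.drop (k - 1) = part n k :: n.drop k := by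
  rw [List.drop_eq_getElem_cons (by omega), part, List.getD_eq_getElem _ _ (by omega)]
  congr 2; omega

/-- The bounds at level `k` depend on the earlier partitions, so the induction runs over suffixes of
a fixed sequence. -/
theorem drop_mem_boundedSeqs_iff {j k : ℕ} (hk : 1 ≤ k) (hkj : k + j = t + 2)
    (h : (bounds f u N n k).1 ≠ ⊤ ∨ (bounds f u N n k).2 ≠ ⊤) :
    n.drop (k - 1) ∈ boundedSeqs f u t j k (bounds f u N n k).1 (bounds f u N n k).2 ↔
      k ≤ n.length ∧ u ≤ n.length ∧ n.length ≤ t + 1 ∧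
        ∀ k', k ≤ k' → k' ≤ n.length → AdmissibleAt f t u N n k' := by
  induction j generalizing k with
  | zero =>
    simp only [boundedSeqs, Finset.notMem_empty, false_iff]
    omega
  | succ j ih =>
    rcases lt_or_ge n.length k with hkn | hkn
    · rw [List.drop_eq_nil_of_le (by omega)]
      exact iff_of_false (nil_notMem_boundedSeqs _ _ _ _) (by omega)
    rw [drop_sub_one_eq_cons hk hkn, boundedSeqs]
    simp only [Finset.mem_biUnion, Finset.mem_image, List.cons.injEq, Finset.mem_union]
    have e1 : ∀ (p : Prop) [Decidable p] (s : Finset (List (List ℕ))) (a : List (List ℕ)),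
        (a ∈ if p then s else ∅) ↔ p ∧ a ∈ s := by
      intro p _ s a; split_ifs with hp <;> simp [hp]
    simp only [e1, Finset.mem_singleton]
    constructor
    · rintro ⟨P, hP, l, hl, rfl, rfl⟩
      rw [mem_boundedParts h] at hP
      obtain ⟨hP1, hP2, hP3⟩ := hP
      have hlast := entry_eq_lastEntry (u := u) (N := N) hP1
      rcases hl with ⟨⟨h1, h2, h3⟩, h4⟩ | ⟨⟨h1, h2⟩, h3⟩
      · have hlen : k = n.length := by
          have := List.drop_eq_nil_iff.1 h4
          omega
        refine ⟨hkn, hlen ▸ h1, by omega, fun k' hk1 hk2 => ?_⟩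
        obtain rfl : k' = k := by omega
        exact ⟨hP1, hP2, hP3, fun _ => h2, fun _ _ => by omega, fun _ _ => by omega,
          fun _ h => hlast.trans (h3 h)⟩
      · rw [← bounds_succ hk hP1] at h3
        have hne := nextBounds_ne_top (u := u) (k := k) (s := (part n k).sum)
          (h.imp id fun h => lastEntry_ne_top (P := part n k) (Or.inl h))
        rw [← bounds_succ hk hP1] at hne
        have h4 := (ih (k := k + 1) (by omega) (by omega) hne).1 h3
        refine ⟨hkn, h4.2.1, h4.2.2.1, fun k' hk1 hk2 => ?_⟩
        rcases hk1.eq_or_lt with rfl | hk1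
        · exact ⟨hP1, hP2, hP3, fun _ => by omega, fun h _ => h1 h,
            fun h _ => by rw [hlast]; exact h2 h, fun _ _ => by omega⟩
        · exact h4.2.2.2 k' hk1 hk2
    · rintro ⟨-, hu, ht, hA⟩
      have hAk := hA k le_rfl hkn
      have hlast := entry_eq_lastEntry (u := u) (N := N) hAk.length_part
      refine ⟨part n k, (mem_boundedParts h).2 ⟨hAk.length_part, hAk.antitone, hAk.wt_le⟩,
        n.drop k, ?_, rfl, rfl⟩
      rcases hkn.eq_or_lt with hkn | hkn
      · refine Or.inl ⟨⟨by omega, hAk.wt_eq hkn, fun h => ?_⟩, by simp [hkn]⟩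
        rw [← hlast]; exact hAk.last_eq_zero hkn h
      · refine Or.inr ⟨⟨fun h => hAk.wt_lt h (by omega), fun h => ?_⟩, ?_⟩
        · rw [← hlast]; exact hAk.last_pos h hkn
        · have hne := nextBounds_ne_top (u := u) (k := k) (s := (part n k).sum)
            (h.imp id fun h => lastEntry_ne_top (P := part n k) (Or.inl h))
          rw [← bounds_succ hk hAk.length_part] at hne ⊢
          exact (ih (k := k + 1) (by omega) (by omega) hne).2
            ⟨hkn, hu, ht, fun k' hk1 hk2 => hA k' (by omega) hk2⟩

theorem mem_boundedSeqs_iff {c : ℕ → ℕ} {d : ℕ} (hu : 1 ≤ u) :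
    n ∈ boundedSeqs (fSeq c u d) u t (t + 1) 1 ⊤ N ↔ Admissible c t u d N n := by
  have := drop_mem_boundedSeqs_iff (f := fSeq c u d) (u := u) (t := t) (N := N) (n := n)
    (j := t + 1) (k := 1) le_rfl (by omega) (Or.inr (by simp [bounds]))
  rw [admissible_iff hu]
  refine this.trans ⟨fun h => h.2, fun h => ⟨by omega, h⟩⟩

/-! ### Summands of the fermionic sum as products over partitions -/

theorem seqTerm_drop {k : ℕ} (hk : 1 ≤ k)
    (h : ∀ k', k ≤ k' → k' ≤ n.length → (part n k').length = f k') :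
    seqTerm u k (bounds f u N n k).1 (bounds f u N n k).2 (n.drop (k - 1)) =
      ∏ k' ∈ Finset.Icc k n.length,
        partTerm (partExp u k') (bounds f u N n k').1 (bounds f u N n k').2 (part n k') *
          (if k' = u then q ^ (lastEntry (bounds f u N n k').2 (part n k')).toNat else 1) := by
  induction hm : n.length + 1 - k generalizing k with
  | zero =>
    rw [List.drop_eq_nil_of_le (by omega), Finset.Icc_eq_empty (by omega)]
    simp [seqTerm]
  | succ m ih =>
    rw [drop_sub_one_eq_cons hk (by omega), seqTerm, ← bounds_succ hk (h k le_rfl (by omega)),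
      ← Finset.insert_Icc_succ_left_eq_Icc (by omega : k ≤ n.length), Finset.prod_insert (by simp),
      Nat.succ_eq_succ, Nat.succ_eq_add_one, ← ih (k := k + 1) (by omega) (fun k' h1 h2 => h k' (by omega) h2) (by omega),
      Nat.add_sub_cancel, mul_assoc]

end

theorem prod_Icc_one_eq_prod_range (m : ℕ) (g : ℕ → RatFunc ℚ) :
    ∏ i ∈ Finset.Icc 1 m, g i = ∏ i ∈ Finset.range m, g (i + 1) := by
  induction m with
  | zero => simp
  | succ m ih => rw [Finset.prod_Icc_succ_top (by omega), ih, Finset.prod_range_succ]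

theorem sum_Icc_one_eq_sum_range {R : Type*} [AddCommMonoid R] (m : ℕ) (g : ℕ → R) :
    ∑ i ∈ Finset.Icc 1 m, g i = ∑ i ∈ Finset.range m, g (i + 1) := by
  induction m with
  | zero => simp
  | succ m ih => rw [Finset.sum_Icc_succ_top (by omega), ih, Finset.sum_range_succ]

theorem prod_Icc_two_eq_prod_range (m : ℕ) (g : ℕ → RatFunc ℚ) :
    ∏ i ∈ Finset.Icc 2 (m + 1), g i = ∏ i ∈ Finset.range m, g (i + 2) := by
  induction m with
  | zero => simp
  | succ m ih => rw [Finset.prod_Icc_succ_top (by omega), ih, Finset.prod_range_succ]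

theorem list_sum_eq_sum_range (P : List ℕ) :
    P.sum = ∑ i ∈ Finset.range P.length, P.getD i 0 := by
  induction P with
  | nil => simp
  | cons a P ih => simp [Finset.sum_range_succ', ih, add_comm]

theorem qPoch_inv_eq (m : ℕ) : 1 / qPoch m = invPoch m := by rw [invPoch_natCast, one_div]

section

variable {f : ℕ → ℕ} {u t N : ℕ} {n : List (List ℕ)}

theorem entry_succ (k i : ℕ) : entry f u N n k (i + 1) = entryNat f u N n k (i + 1) := by
  simp [entryNat, entry]

theorem entryNat_succ (k i : ℕ) : entryNat f u N n k (i + 1) = (part n k).getD i 0 := by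
  simp [entryNat, entry]

/-- The product of the Burge coefficients of the `k`-th partition. -/
noncomputable def coeffProd (f : ℕ → ℕ) (u N : ℕ) (n : List (List ℕ)) (k : ℕ) : RatFunc ℚ :=
  ∏ i ∈ Finset.range (f k),
    burgeCoeff (wBound f u N n k - (∑ j ∈ Finset.range i, entryNat f u N n k (j + 1) : ℕ))
      (entry f u N n k i) (entryNat f u N n k (i + 1))

theorem partTerm_eq_mul_coeffProd {k : ℕ} (h : (part n k).length = f k) (e : ℕ → ℕ) :
    partTerm e (bounds f u N n k).1 (bounds f u N n k).2 (part n k) =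
      q ^ (∑ i ∈ Finset.Icc 1 (f k), e (entryNat f u N n k i)) * coeffProd f u N n k := by
  rw [partTerm_eq_prod, Finset.prod_mul_distrib, sum_Icc_one_eq_sum_range, ← Finset.prod_pow_eq_pow_sum,
    h, coeffProd]
  simp only [entryNat_succ]
  rfl

theorem seqTerm_eq {d : ℕ} (hu : 1 ≤ u) (hun : u ≤ n.length) (hd : f u = d)
    (h : ∀ k, 1 ≤ k → k ≤ n.length → (part n k).length = f k) :
    seqTerm u 1 ⊤ N n = q ^ fermExponent f u d N n *
      ∏ k ∈ Finset.Icc 1 n.length, coeffProd f u N n k := by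
  have h1 := seqTerm_drop (f := f) (u := u) (N := N) (n := n) le_rfl h
  rw [Nat.sub_self, List.drop_zero] at h1
  refine Eq.trans h1 ?_
  have h2 : ∀ k ∈ Finset.Icc 1 n.length,
      partTerm (partExp u k) (bounds f u N n k).1 (bounds f u N n k).2 (part n k) *
        (if k = u then q ^ (lastEntry (bounds f u N n k).2 (part n k)).toNat else 1) =
      q ^ (∑ i ∈ Finset.Icc 1 (f k), partExp u k (entryNat f u N n k i)) *
        (if k = u then q ^ (entryNat f u N n u d) else 1) * coeffProd f u N n k := by
    intro k hk
    rw [Finset.mem_Icc] at hk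
    rw [partTerm_eq_mul_coeffProd (h k hk.1 hk.2), mul_right_comm]
    congr 2
    split_ifs with hku
    · subst hku
      rw [entryNat, ← hd, entry_eq_lastEntry (h k hk.1 hk.2)]
    · rfl
  rw [Finset.prod_congr rfl h2, Finset.prod_mul_distrib, Finset.prod_mul_distrib,
    Finset.prod_ite_eq' , if_pos (Finset.mem_Icc.2 ⟨hu, hun⟩), Finset.prod_pow_eq_pow_sum,
    ← pow_add, fermExponent]
  congr 2
  have h3 : Finset.Icc 1 n.length = Finset.Icc 1 u ∪ Finset.Icc (u + 1) n.length := by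
    ext k; simp only [Finset.mem_union, Finset.mem_Icc]; omega
  have h4 : Disjoint (Finset.Icc 1 u) (Finset.Icc (u + 1) n.length) := by
    rw [Finset.disjoint_left]; intro k; simp only [Finset.mem_Icc]; omega
  rw [h3, Finset.sum_union h4, add_comm, ← add_assoc]
  congr 1
  · congr 1
    refine Finset.sum_congr rfl fun k hk => Finset.sum_congr rfl fun i _ => ?_
    rw [partExp, if_pos (Finset.mem_Icc.1 hk).2]
  · refine Finset.sum_congr rfl fun k hk => Finset.sum_congr rfl fun i _ => ?_
    rw [partExp, if_neg (by have := (Finset.mem_Icc.1 hk).1; omega)]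

theorem coeffProd_eq_invFactor {k : ℕ} (hA : AdmissibleAt f t u N n k)
    (hw : wBound f u N n k = ⊤) (htop : (bounds f u N n k).2 ≠ ⊤) :
    coeffProd f u N n k = invFactor f u N n k := by
  rw [coeffProd, invFactor, prod_Icc_one_eq_prod_range]
  refine Finset.prod_congr rfl fun i hi => ?_
  rw [Finset.mem_range] at hi
  have h1 : entry f u N n k i = entryNat f u N n k i := by
    cases i with
    | zero => exact (ENat.natCast_toNat htop).symm
    | succ i => exact entry_succ k i
  have h2 := hA.antitone (i + 1) (by omega) hi
  rw [Nat.add_sub_cancel, h1, entry_succ, ENat.natCast_le_natCast] at h2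
  rw [hw, ENat.top_sub_natCast, h1, burgeCoeff_top_left, Nat.add_sub_cancel, qPoch_inv_eq,
    Nat.cast_sub h2]

/-- The factors of `gaussFactor`. -/
noncomputable def gaussAt (f : ℕ → ℕ) (u N : ℕ) (n : List (List ℕ)) (k i : ℕ) : RatFunc ℚ :=
  gauss
    (2 * (((wBound f u N n k).toNat : ℤ) - ∑ j ∈ Finset.Icc 1 i, (entryNat f u N n k j : ℤ))
      + entryNat f u N n k (i - 1) + entryNat f u N n k i)
    ((entryNat f u N n k (i - 1) : ℤ) - entryNat f u N n k i)

theorem burgeCoeff_eq_gaussAt {k i : ℕ} (hA : AdmissibleAt f t u N n k)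
    (hw : wBound f u N n k ≠ ⊤) (htop : entry f u N n k i ≠ ⊤) (hi : i < f k) :
    burgeCoeff (wBound f u N n k - (∑ j ∈ Finset.range i, entryNat f u N n k (j + 1) : ℕ))
      (entry f u N n k i) (entryNat f u N n k (i + 1)) = gaussAt f u N n k (i + 1) := by
  have h1 : entry f u N n k i = entryNat f u N n k i := (ENat.natCast_toNat htop).symm
  obtain ⟨W, hW⟩ := ENat.ne_top_iff_exists.1 hw
  have h2 : ∑ j ∈ Finset.range i, entryNat f u N n k (j + 1) ≤ W := by
    have h3 := hA.wt_le
    rw [← hW, ENat.natCast_le_natCast, wt, list_sum_eq_sum_range, hA.length_part] at h3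
    refine le_trans ?_ h3
    simp only [entryNat_succ]
    exact Finset.sum_le_sum_of_subset (Finset.range_subset_range.2 hi.le)
  rw [h1, ← hW, ← ENat.natCast_sub, burgeCoeff_natCast, gaussAt, ← hW, ENat.toNat_natCast,
    Nat.cast_sub h2, sum_Icc_one_eq_sum_range, Finset.sum_range_succ, Nat.add_sub_cancel]
  congr 1
  push_cast
  ring

theorem coeffProd_eq_prod_gaussAt {k : ℕ} (hA : AdmissibleAt f t u N n k)
    (hw : wBound f u N n k ≠ ⊤) (htop : (bounds f u N n k).2 ≠ ⊤) :
    coeffProd f u N n k = ∏ i ∈ Finset.Icc 1 (f k), gaussAt f u N n k i := by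
  rw [coeffProd, prod_Icc_one_eq_prod_range]
  refine Finset.prod_congr rfl fun i hi => burgeCoeff_eq_gaussAt hA hw ?_ (Finset.mem_range.1 hi)
  cases i with
  | zero => exact htop
  | succ i => rw [entry_succ]; simp

theorem coeffProd_eq_mul_prod_gaussAt {k : ℕ} (hA : AdmissibleAt f t u N n k)
    (hw : wBound f u N n k ≠ ⊤) (htop : (bounds f u N n k).2 = ⊤)
    (hf : f k = 0 → wBound f u N n k = 0) :
    coeffProd f u N n k = 1 / qPoch (2 * (wBound f u N n k).toNat) *
      ∏ i ∈ Finset.Icc 2 (f k), gaussAt f u N n k i := by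
  rcases hm : f k with _ | m
  · simp [coeffProd, hm, hf hm]
  · rw [coeffProd, hm, prod_Icc_two_eq_prod_range, Finset.prod_range_succ', mul_comm]
    congr 1
    · obtain ⟨W, hW⟩ := ENat.ne_top_iff_exists.1 hw
      have h0 : entry f u N n k 0 = ⊤ := htop
      rw [Finset.sum_range_zero, Nat.cast_zero, tsub_zero, ← hW, h0, burgeCoeff_top_right,
        ENat.toNat_natCast, qPoch_inv_eq]
      push_cast; rfl
    · refine Finset.prod_congr rfl fun i hi => burgeCoeff_eq_gaussAt hA hw ?_ ?_
      · rw [entry_succ]; simp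
      · have := Finset.mem_range.1 hi; omega

theorem nextBounds_ne_top_both {k s : ℕ} {w m : ℕ∞} (hw : w ≠ ⊤) (hm : m ≠ ⊤) :
    (nextBounds u k w s m).1 ≠ ⊤ ∧ (nextBounds u k w s m).2 ≠ ⊤ := by
  lift w to ℕ using hw
  lift m to ℕ using hm
  unfold nextBounds
  split_ifs <;> constructor <;> norm_cast <;> exact ENat.natCast_ne_top _

/-- Level `m` is where an infinite `n_{m,0}` meets a finite `w_m`: its first Burge coefficient is
`1/(q)_{2 w_m}`, which replaces the omitted Gaussian. By `hf` a part follows before any later level,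
so the later bounds are finite. -/
theorem prod_coeffProd_eq {m : ℕ} (hm : 1 ≤ m) (hmn : m ≤ n.length)
    (hA : ∀ k, 1 ≤ k → k ≤ n.length → AdmissibleAt f t u N n k)
    (hw : wBound f u N n m ≠ ⊤) (htop : (bounds f u N n m).2 = ⊤)
    (hf : m < n.length → 1 ≤ f m) :
    ∏ k ∈ Finset.Icc m n.length, coeffProd f u N n k =
      1 / qPoch (2 * (wBound f u N n m).toNat) * gaussFactor f u N n m := by
  have hfin : ∀ k, m < k → k ≤ n.length →
      (bounds f u N n k).1 ≠ ⊤ ∧ (bounds f u N n k).2 ≠ ⊤ := by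
    intro k hmk
    induction k, hmk using Nat.le_induction with
    | base =>
      intro hk
      rw [Nat.succ_eq_add_one, bounds_succ hm (hA m hm hmn).length_part]
      refine nextBounds_ne_top_both hw (lastEntry_ne_top (Or.inr fun h => ?_))
      have h1 := (hA m hm hmn).length_part
      have h2 := hf hk
      rw [h, List.length_nil] at h1
      omega
    | succ k hmk ih =>
      intro hk
      have hmk' : m < k := hmk
      have h1 := ih (by omega)
      rw [bounds_succ (by omega) (hA k (by omega) (by omega)).length_part]
      exact nextBounds_ne_top_both h1.1 (lastEntry_ne_top (Or.inl h1.2))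
  have hgf : gaussFactor f u N n m = ∏ k ∈ Finset.Icc m n.length,
    ∏ i ∈ Finset.Icc (1 + if k = m then 1 else 0) (f k), gaussAt f u N n k i := rfl
  rw [hgf, ← Finset.insert_Icc_succ_left_eq_Icc hmn, Finset.prod_insert (by simp),
    Finset.prod_insert (by simp), coeffProd_eq_mul_prod_gaussAt (hA m hm hmn) hw htop, if_pos rfl,
    mul_assoc]
  · congr 2
    refine Finset.prod_congr rfl fun k hk => ?_
    rw [Nat.succ_eq_succ, Nat.succ_eq_add_one, Finset.mem_Icc] at hk
    have h1 := hfin k (by omega) hk.2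
    rw [coeffProd_eq_prod_gaussAt (hA k (by omega) hk.2) h1.1 h1.2, if_neg (by omega)]
  · intro h0
    have hmn' : m = n.length := by
      by_contra hne
      have := hf (by omega)
      omega
    have h1 := (hA m hm hmn).wt_eq hmn'
    have h2 := (hA m hm hmn).length_part
    rw [h0, List.length_eq_zero_iff] at h2
    rw [← h1, wt, h2]
    simp

theorem prod_Icc_eq_mul {m x : ℕ} (h : m ≤ x) (g : ℕ → RatFunc ℚ) :
    ∏ k ∈ Finset.Icc m x, g k = g m * ∏ k ∈ Finset.Icc (m + 1) x, g k := by
  rw [← Finset.insert_Icc_succ_left_eq_Icc h, Finset.prod_insert (by simp)]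
  rfl

theorem bounds_one : bounds f u N n 1 = (⊤, (N : ℕ∞)) := rfl

/-- Only level 1 has infinite width. Passing to level 2 exchanges the bounds, which gives `w₂ =
n_{1,f₁}` and `n_{2,0} = ∞`. -/
theorem seqTerm_eq_fermTerm {d : ℕ} (hu : 1 < u) (hun : u ≤ n.length) (hd : f u = d)
    (hA : ∀ k, 1 ≤ k → k ≤ n.length → AdmissibleAt f t u N n k)
    (hf : 2 < n.length → 1 ≤ f 2) :
    seqTerm u 1 ⊤ N n = fermTerm f u d N n := by
  have h1 := hA 1 le_rfl (by omega)
  have hb := bounds_succ (u := u) (N := N) le_rfl h1.length_part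
  rw [bounds_one, nextBounds, if_pos (by omega), ENat.top_sub_natCast] at hb
  have hlast : wBound f u N n 2 = entry f u N n 1 (f 1) := by
    rw [entry_eq_lastEntry h1.length_part, wBound, hb]; rfl
  have hlast' : (wBound f u N n 2).toNat = entryNat f u N n 1 (f 1) := by rw [hlast, entryNat]
  rw [seqTerm_eq (by omega) hun hd fun k hk hk' => (hA k hk hk').length_part,
    prod_Icc_eq_mul (by omega), coeffProd_eq_invFactor h1 rfl (by simp [bounds_one]),
    prod_coeffProd_eq (by omega) (by omega) hA ?_ (by rw [hb]) hf, hlast', fermTerm]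
  · ring
  · rw [hlast, entry_eq_lastEntry h1.length_part]
    exact lastEntry_ne_top (Or.inl (by simp [bounds_one]))

/-- Without an exchange after level 1, levels 1 and 2 both have infinite width. A finite weight
cannot equal it, so `x ≥ 3`, and the infinite `n_{k,0}` occurs at `k = 3`. -/
theorem seqTerm_eq_fermTermOne {d : ℕ} (hun : 1 ≤ n.length) (hd : f 1 = d)
    (hA : ∀ k, 1 ≤ k → k ≤ n.length → AdmissibleAt f t 1 N n k)
    (hf : 3 < n.length → 1 ≤ f 3) :
    seqTerm 1 1 ⊤ N n = fermTermOne f d N n := by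
  have h1 := hA 1 le_rfl hun
  have hlen1 : 1 ≠ n.length := fun h => by
    have := h1.wt_eq h
    simp [wBound, bounds_one] at this
  have hb2 := bounds_succ (u := 1) (N := N) le_rfl h1.length_part
  have ht1 : (⊤ : ℕ∞) - 1 = ⊤ := ENat.top_sub_natCast 1
  rw [bounds_one, nextBounds, if_neg (by omega), if_pos rfl, ht1, ENat.top_sub_natCast] at hb2
  have h2 := hA 2 (by omega) (by omega)
  have hw2 : wBound f 1 N n 2 = ⊤ := by rw [wBound, hb2]
  have htop2 : (bounds f 1 N n 2).2 ≠ ⊤ := by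
    rw [hb2]
    have : lastEntry (N : ℕ∞) (part n 1) ≠ ⊤ := lastEntry_ne_top (Or.inl (by simp))
    simpa using this
  have hlen2 : 2 ≠ n.length := fun h => by
    have := h2.wt_eq h
    simp [hw2] at this
  have hb3 := bounds_succ (u := 1) (N := N) (by omega) h2.length_part
  rw [show (bounds f 1 N n 2).1 = ⊤ from hw2, nextBounds, if_neg (by omega), if_neg (by omega),
    top_add, ENat.top_sub_natCast, ← entry_eq_lastEntry h2.length_part] at hb3
  have hne : entry f 1 N n 2 (f 2) ≠ ⊤ := by
    rw [entry_eq_lastEntry h2.length_part]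
    exact lastEntry_ne_top (Or.inl htop2)
  obtain ⟨m, hm⟩ := ENat.ne_top_iff_exists.1 hne
  have hw3 : wBound f 1 N n 3 = ((m - 1 : ℕ) : ℕ∞) := by
    rw [wBound, hb3, ← hm]; rfl
  have hw3' : (wBound f 1 N n 3).toNat = entryNat f 1 N n 2 (f 2) - 1 := by
    rw [hw3, entryNat, ← hm]; rfl
  rw [seqTerm_eq le_rfl hun hd fun k hk hk' => (hA k hk hk').length_part,
    prod_Icc_eq_mul (by omega), prod_Icc_eq_mul (by omega),
    coeffProd_eq_invFactor h1 rfl (by simp [bounds_one]), coeffProd_eq_invFactor h2 hw2 htop2,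
    prod_coeffProd_eq (by omega) (by omega) hA (by rw [hw3]; simp) (by rw [hb3]) hf, hw3',
    fermTermOne]
  ring

end

/-! ### Continued fractions -/

theorem cfFold_contFrac (s r : ℕ) (h : Nat.Coprime s r) :
    cfFold (contFrac s r) (1, 0) = ((s : ℤ), (r : ℤ)) := by
  induction r using Nat.strong_induction_on generalizing s with
  | _ r ih =>
    rw [contFrac]
    split_ifs with hr
    · subst hr
      simp [(Nat.coprime_zero_right s).1 h]
    · rw [cfFold_cons, ih (s % r) (Nat.mod_lt _ (Nat.pos_of_ne_zero hr)) r ?_]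
      · have := Nat.div_add_mod s r
        ext
        · zify at this
          simp only
          push_cast
          linarith
        · rfl
      · rw [Nat.Coprime, Nat.gcd_comm, ← Nat.gcd_rec, Nat.gcd_comm]; exact h

/-- The endings `a + 1` and `a, 1` have the same continuants, so the identification is harmless. -/
theorem IsContFrac.cfFold_eq {l : List ℕ} {s r : ℕ} (h : IsContFrac l s r) :
    cfFold l (1, 0) = ((s : ℤ), (r : ℤ)) := by
  obtain ⟨-, hc, rfl | ⟨l', a, h1, rfl⟩⟩ := h
  · exact cfFold_contFrac s r hc
  · rw [← cfFold_contFrac s r hc, h1, cfFold_append, cfFold_append]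
    simp

theorem one_le_of_contFrac_eq {s r a b : ℕ} {l : List ℕ} (h : contFrac s r = a :: b :: l) :
    1 ≤ b := by
  rw [contFrac] at h
  split_ifs at h with hr
  have h1 := (List.cons.inj h).2
  rw [contFrac] at h1
  split_ifs at h1 with hr'
  rw [← (List.cons.inj h1).1]
  exact Nat.div_pos (Nat.mod_lt _ (Nat.pos_of_ne_zero hr)).le (Nat.pos_of_ne_zero hr')

section

variable {c : ℕ → ℕ} {t u d p p' r s : ℕ}

/-- The last entry `c t + 2` is not `1`, so the expansion is the canonical one, whose entries after
the first are positive. As `t ≥ 3`, the second entry is `c 2` itself. -/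
theorem one_le_second_of_isContFrac (ht : 3 ≤ t)
    (hc : IsContFrac ((List.range' 1 (t - 1)).map c ++ [c t + 2]) p' p) : 1 ≤ c 2 := by
  obtain ⟨-, -, h | ⟨l', a, -, h⟩⟩ := hc
  · obtain ⟨m, rfl⟩ := Nat.exists_eq_add_of_le' ht
    rw [show m + 3 - 1 = m + 1 + 1 by omega, List.range'_succ, List.range'_succ] at h
    exact one_le_of_contFrac_eq h.symm
  · rw [show l' ++ [a, 1] = (l' ++ [a]) ++ [1] by simp] at h
    have := (List.append_inj' h rfl).2
    simp at this

theorem map_fSeq_range' (m : ℕ) (h : 1 + m ≤ u) :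
    (List.range' 1 m).map (fSeq c u d) = (List.range' 1 m).map c := by
  refine List.map_congr_left fun k hk => ?_
  rw [List.mem_range'_1] at hk
  rw [fSeq, if_pos (by omega)]

/-- The contributions `d` and `c u - d` recombine to `c u`. -/
theorem branchPair_fSeq (hut : u ≤ t) (hdc : d ≤ c u) :
    branchPair (fSeq c u d) u t = cfFold ((List.range' u (t + 1 - u)).map c) (1, 2) := by
  obtain ⟨m, hm⟩ : ∃ m, t + 1 - u = m + 1 := ⟨t - u, by omega⟩
  have h1 : (List.range' (u + 1 + 1) m).map (fSeq c u d) = (List.range' (u + 1) m).map c := by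
    rw [List.range'_succ_left, List.map_map]
    refine List.map_congr_left fun k hk => ?_
    rw [List.mem_range'_1] at hk
    rw [Function.comp, fSeq, if_neg (by omega), if_neg (by omega), if_neg (by omega),
      Nat.add_sub_cancel]
  rw [branchPair, hm, List.range'_succ, List.map_cons, h1, List.range'_succ, List.map_cons]
  simp only [cfFold_cons]
  rw [show fSeq c u d u = d by simp [fSeq], show fSeq c u d (u + 1) = c u - d by simp [fSeq],
    Nat.cast_sub hdc]
  congr 1; ring

theorem cfFold_branchPair (hu : 1 ≤ u) (hut : u ≤ t) (hdc : d ≤ c u)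
    (hc : IsContFrac ((List.range' 1 (t - 1)).map c ++ [c t + 2]) p' p) :
    cfFold ((List.range' 1 (u - 1)).map (fSeq c u d)) (branchPair (fSeq c u d) u t) = ((p' : ℤ), (p : ℤ)) := by
  rw [map_fSeq_range' _ (by omega), branchPair_fSeq hut hdc, ← cfFold_append, ← List.map_append]
  have h1 : List.range' 1 (u - 1) ++ List.range' u (t + 1 - u) = List.range' 1 (t - 1) ++ [t] := by
    have h2 := List.range'_append (s := 1) (m := u - 1) (n := t + 1 - u) (step := 1)
    have h3 := List.range'_append (s := 1) (m := t - 1) (n := 1) (step := 1)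
    rw [show 1 + 1 * (u - 1) = u by omega, show u - 1 + (t + 1 - u) = t by omega] at h2
    rw [show 1 + 1 * (t - 1) = t by omega, show t - 1 + 1 = t by omega] at h3
    rw [h2, ← h3, List.range'_one]
  rw [h1, ← hc.cfFold_eq, List.map_append, cfFold_append, cfFold_append]
  simp

theorem cfFold_fSeq (hu : 1 ≤ u) (hrs : IsContFrac ((List.range' 1 (u - 1)).map c ++ [d]) s r) :
    cfFold ((List.range' 1 (u - 1)).map (fSeq c u d)) (d, 1) = ((s : ℤ), (r : ℤ)) := by
  rw [map_fSeq_range' _ (by omega), ← hrs.cfFold_eq, cfFold_append]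
  simp

/-- At the branching level `(d, 1)` is componentwise at most the remaining pair, and continuants are
monotone. -/
theorem le_of_isContFrac (hu : 1 ≤ u) (hut : u ≤ t) (hdc : d ≤ c u)
    (hc : IsContFrac ((List.range' 1 (t - 1)).map c ++ [c t + 2]) p' p)
    (hrs : IsContFrac ((List.range' 1 (u - 1)).map c ++ [d]) s r) : s ≤ p' ∧ r ≤ p := by
  have hpos := cfFold_pos (l := (List.range' (u + 1) (t + 1 - u)).map (fSeq c u d)) (x := (1, 2))
    one_pos two_pos
  have hle := cfFold_le (l := (List.range' 1 (u - 1)).map (fSeq c u d)) (x := ((d : ℤ), (1 : ℤ)))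
    (y := branchPair (fSeq c u d) u t) (by positivity) ?_ zero_le_one hpos.2
  · rw [cfFold_branchPair hu hut hdc hc, cfFold_fSeq hu hrs] at hle
    exact ⟨Nat.cast_le.1 hle.1.2, Nat.cast_le.1 hle.2.2⟩
  · have h1 : (fSeq c u d u : ℤ) = d := by simp [fSeq]
    simp only [branchPair, h1]
    nlinarith [hpos.1, hpos.2, Nat.cast_nonneg (α := ℤ) d]

/-! ### The bosonic side -/

theorem bosonicTerm_eq (N : ℕ) (k : ℤ) :
    bosonicTerm p p' r s N k = qPoch (2 * N) * bosTerm p' p s r ⊤ N k := by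
  have h : ((2 : ℤ) * N).toNat = 2 * N := by omega
  rw [bosonicTerm, bosTerm, gaussPair_top_left, gaussPair_top_left, gauss_eq, gauss_eq, h,
    show (2 : ℤ) * N - (N + p * k) = N - k * p by ring,
    show (2 : ℤ) * N - (N + p * k + r) = N - (k * p + r) by ring,
    show (N : ℤ) + p * k + r = N + (k * p + r) by ring, mul_comm (p : ℤ) k]
  ring

/-- The polynomials in `q` with integer coefficients. -/
noncomputable def intPoly : Subalgebra ℤ (RatFunc ℚ) := (Polynomial.aeval (R := ℤ) q).range

theorem q_zpow_mem {e : ℤ} (he : 0 ≤ e) : q ^ e ∈ intPoly := by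
  obtain ⟨n, rfl⟩ := Int.eq_ofNat_of_zero_le he
  rw [zpow_natCast]
  have h : q ∈ intPoly := ⟨Polynomial.X, Polynomial.aeval_X q⟩
  exact pow_mem h n

theorem gauss_mem_intPoly (P : ℕ) (N : ℤ) : gauss P N ∈ intPoly := by
  induction P generalizing N with
  | zero =>
    rcases eq_or_ne N 0 with rfl | hN
    · rw [gauss_zero_right]; exact one_mem _
    · rw [gauss_eq_zero (by omega)]; exact zero_mem _
  | succ P ih =>
    rcases lt_or_ge N 0 with hN | hN
    · rw [gauss_eq_zero (by omega)]; exact zero_mem _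
    · have h := gauss_pascal (P := P) (N := N - 1) (by omega)
      rw [sub_add_cancel] at h
      rw [Nat.cast_add, Nat.cast_one, h]
      exact add_mem (ih _) (mul_mem (q_zpow_mem hN) (ih _))

/-- The bounds `s ≤ p'` and `r ≤ p` keep all exponents of `q` non-negative. -/
theorem bosonicTerm_mem_intPoly (hs : s ≤ p') (hr : r ≤ p) (hp : 0 < p) (hp' : 0 < p') (N : ℕ)
    (k : ℤ) : bosonicTerm p p' r s N k ∈ intPoly := by
  have hs' : (s : ℤ) ≤ p' := by exact_mod_cast hs
  have hr' : (r : ℤ) ≤ p := by exact_mod_cast hr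
  have h2N : (2 : ℤ) * N = ((2 * N : ℕ) : ℤ) := by push_cast; ring
  rw [bosonicTerm, h2N]
  refine sub_mem (mul_mem (q_zpow_mem ?_) (gauss_mem_intPoly _ _))
    (mul_mem (q_zpow_mem ?_) (gauss_mem_intPoly _ _))
  · rcases lt_trichotomy k 0 with hk | rfl | hk
    · have h1 : 0 ≤ -k * p - r := by nlinarith
      have h2 : 0 ≤ -k * p' * (-k * p - r) := mul_nonneg (mul_nonneg (by omega) (by omega)) h1
      have h3 : 0 ≤ -k * (p * s) := mul_nonneg (by omega) (by positivity)
      linarith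
    · simp
    · have h1 : 0 ≤ k * p' - s := by nlinarith
      have h2 : 0 ≤ k * p * (k * p' - s) := mul_nonneg (by positivity) h1
      have h3 : 0 ≤ k * (p' * r) := by positivity
      linarith
  · rw [mul_comm]
    exact linear_mul_linear_nonneg (by exact_mod_cast hp') (by exact_mod_cast hp) (by positivity)
      hs' (by positivity) hr' k

theorem exists_finsum_bosonicTerm_eq_aeval (hs : s ≤ p') (hr : r ≤ p) (hp : 0 < p) (hp' : 0 < p')
    (N : ℕ) : ∃ P : Polynomial ℤ, ∑ᶠ k : ℤ, bosonicTerm p p' r s N k = Polynomial.aeval q P := by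
  have h : ∑ᶠ k : ℤ, bosonicTerm p p' r s N k ∈ intPoly :=
    finsum_induction (· ∈ intPoly) (zero_mem _) (fun _ _ => add_mem)
      (bosonicTerm_mem_intPoly hs hr hp hp' N)
  obtain ⟨P, hP⟩ := h
  exact ⟨P, hP.symm⟩

theorem finsum_bosonicTerm_eq (hu : 1 ≤ u) (hut : u ≤ t) (hd : 1 ≤ d) (hdc : d ≤ c u)
    (hc : IsContFrac ((List.range' 1 (t - 1)).map c ++ [c t + 2]) p' p)
    (hrs : IsContFrac ((List.range' 1 (u - 1)).map c ++ [d]) s r) (N : ℕ) :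
    ∑ᶠ k : ℤ, bosonicTerm p p' r s N k =
      qPoch (2 * N) * ∑ n ∈ boundedSeqs (fSeq c u d) u t (t + 1) 1 ⊤ N, seqTerm u 1 ⊤ N n := by
  have hfu : fSeq c u d u = d := by simp [fSeq]
  have h := sum_seqTerm_head (f := fSeq c u d) (u := u) (t := t) (k := 1) (i := u - 1) (w := ⊤)
    (top := N) hut (by omega) (by omega) (Or.inr (by simp))
  rw [hfu, cfFold_branchPair hu hut hdc hc, cfFold_fSeq hu hrs, Nat.add_sub_cancel] at h
  rw [h, bosSum, mul_finsum]
  exact finsum_congr fun k => bosonicTerm_eq N k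

end

end BurgeTree

theorem mainTheorem5 (p p' : ℕ) (hp : 0 < p) (hp' : 0 < p') (hpp' : Nat.Coprime p p')
    (t : ℕ) (ht : 1 ≤ t) (c : ℕ → ℕ)
    (hc : BurgeTree.IsContFrac ((List.range' 1 (t - 1)).map c ++ [c t + 2]) p' p)
    (u : ℕ) (hu : 1 ≤ u) (hut : u ≤ t) (d : ℕ) (hd : 1 ≤ d) (hdc : d ≤ c u)
    (r s : ℕ) (hrs : BurgeTree.IsContFrac ((List.range' 1 (u - 1)).map c ++ [d]) s r)
    (N : ℕ) :
    -- both sums have finitely many non-zero terms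
    (Function.support (BurgeTree.bosonicTerm p p' r s N)).Finite ∧
    {n | BurgeTree.Admissible c t u d N n}.Finite ∧
    -- the common value is a polynomial in `q`
    (∃ P : Polynomial ℤ,
      ∑ᶠ k : ℤ, BurgeTree.bosonicTerm p p' r s N k = Polynomial.aeval BurgeTree.q P) ∧
    (1 < u →
      ∑ᶠ k : ℤ, BurgeTree.bosonicTerm p p' r s N k =
        BurgeTree.qPoch (2 * N) *
          ∑ᶠ n ∈ {n | BurgeTree.Admissible c t u d N n},
            BurgeTree.fermTerm (BurgeTree.fSeq c u d) u d N n) ∧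
    (u = 1 →
      ∑ᶠ k : ℤ, BurgeTree.bosonicTerm p p' r s N k =
        BurgeTree.qPoch (2 * N) *
          ∑ᶠ n ∈ {n | BurgeTree.Admissible c t u d N n},
            BurgeTree.fermTermOne (BurgeTree.fSeq c u d) d N n) := by
  open BurgeTree in
  have hle := le_of_isContFrac hu hut hdc hc hrs
  have hset : {n | Admissible c t u d N n} =
      (boundedSeqs (fSeq c u d) u t (t + 1) 1 ⊤ N : Set (List (List ℕ))) :=
    Set.ext fun n => (mem_boundedSeqs_iff hu).symm
  have hfu : fSeq c u d u = d := by simp [fSeq]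
  have hbos := finsum_bosonicTerm_eq hu hut hd hdc hc hrs N
  refine ⟨?_, hset ▸ Finset.finite_toSet _,
    exists_finsum_bosonicTerm_eq_aeval hle.1 hle.2 hp hp' N, fun hu1 => ?_, ?_⟩
  · refine (support_bosTerm_finite (P' := p') (P := p) (S := s) (R := r) (L := ⊤) (M := N)
      (by exact_mod_cast hp') (by exact_mod_cast hp) (Or.inr (by simp))).subset fun k hk => ?_
    rw [Function.mem_support, bosonicTerm_eq] at hk
    exact right_ne_zero_of_mul hk
  · rw [hbos, hset, finsum_mem_coe_finset]
    congr 1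
    refine Finset.sum_congr rfl fun n hn => ?_
    obtain ⟨h1, h2, h3⟩ := (admissible_iff hu).1 ((mem_boundedSeqs_iff hu).1 hn)
    refine seqTerm_eq_fermTerm hu1 h1 hfu h3 fun _ => ?_
    -- Here `f₂` is `d` if `u = 2` and `c 2` if `u > 2`; both are positive.
    rcases Nat.eq_or_lt_of_le hu1 with rfl | hu2
    · exact hfu.symm ▸ hd
    · rw [fSeq, if_pos hu2]
      exact one_le_second_of_isContFrac (by omega) hc
  · rintro rfl
    rw [hbos, hset, finsum_mem_coe_finset]
    congr 1
    refine Finset.sum_congr rfl fun n hn => ?_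
    obtain ⟨h1, h2, h3⟩ := (admissible_iff hu).1 ((mem_boundedSeqs_iff hu).1 hn)
    refine seqTerm_eq_fermTermOne h1 hfu h3 fun h4 => ?_
    rw [fSeq, if_neg (by omega), if_neg (by omega), if_neg (by omega)]
    exact one_le_second_of_isContFrac (by omega) hc
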